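/- Let $\gamma\in O(2)$ be the rotation of $\mathbf R^2$ about the origin through the angle $\pi/2$ and let $F=\langle\gamma\rangle$, a cyclic group of order $4$. Let $F'<O(2)$ be the Klein four-group generated by the reflections across the $x$-axis and the $y$-axis. Let $\Sigma=\mathbf Z^2\rtimes F$ and $\Sigma'=\mathbf Z^2\rtimes F'$, the groups of all motions $x\mapsto \sigma x+v$ with $v\in\mathbf Z^2$ and $\sigma\in F$, respectively $\sigma\in F'$. Both act properly discontinuously on $\mathbf R^2$; let $\mathcal O=\Sigma\backslash\mathbf R^2$ and $\mathcal O'=\Sigma'\backslash\mathbf R^2$ be the resulting closed flat orbifolds. A smooth $p$-form on $\mathcal O$ is a smooth $\Sigma$-invariant $p$-form on $\mathbf R^2$, and likewise for $\mathcal O'$. The $p$-spectrum of $\mathcal O$ (or $\mathcal O'$) is the sequence $0\le\lambda_1\le\lambda_2\le\dots\to\infty$ of eigenvalues, repeated according to multiplicity, of the Hodge Laplacian $d\delta+\delta d$ on $p$-forms, for which there is an orthonormal basis of the square-integrable $p$-forms that consists of smooth eigenforms. The $p$-spectrum of the square $Q=[0,\frac12]^2$ with absolute boundary conditions is defined in the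 same way, with eigenforms $\omega$ that are smooth up to the boundary and satisfy $j^*\iota_\nu\omega=0$ and $j^*\iota_\nu d\omega=0$ on every edge, where $\nu$ is a unit normal of the edge and $j$ its inclusion. Then: 1. $\mathcal O$ is a flat $3$-pillow: its underlying topological space is homeomorphic to the sphere $S^2$, and its singular set consists of exactly three points, namely two cone points of order $4$, the $\Sigma$-orbits of $(0,0)$ and $(\frac12,\frac12)$, and one cone point of order $2$, the $\Sigma$-orbit of $(\frac12,0)$, which is also that of $(0,\frac12)$. 2. The underlying space of $\mathcal O'$ is the square $Q$: the projection $\mathbf R^2\to\mathcal O'$ restricts to a homeomorphism of $Q$ onto the underlying space, which is isometric for the quotient metric, that is, $|x-y|\le|x-gy|$ for all $x,y\in Q$ and $g\in\Sigma'$. The interior points of $Q$ are regular points of $\mathcal O'$, the points of the edges other than the corners are reflector points, and the four corners are dihedral points, with isotropy group generated by reflections across two perpendicular lines. 3. $\mathcal O$ and $\mathcal O'$ are $1$-isospectral, and their common $1$-spectrum is the $1$-spectrum of $Q$ with absolute boundary conditions. In particular the $1$-spectrum of the $3$-pillow $\mathcal O$ equals the $1$-spectrum of the square with absolute boundary conditions.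 -/

import Mathlib

noncomputable section

namespace FlatOrbifold

open MeasureTheory Filter

/-! ### Euclidean motions of the plane and crystallographic groups -/

/-- The Euclidean plane. -/
abbrev Plane : Type := EuclideanSpace ℝ (Fin 2)

/-- The orthogonal group of the plane. -/
abbrev Orth : Type := Plane ≃ₗᵢ[ℝ] Plane

/-- The group of Euclidean motions of the plane. -/
abbrev Motion : Type := Plane ≃ᵃⁱ[ℝ] Plane

/-- The tautological action of the Euclidean motions on the plane. -/
instance : MulAction Motion Plane where
  smul g x := g x
  one_smul _ := rfl
  mul_smul _ _ _ := rfl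

/-- The projection of the motion group onto the orthogonal group. -/
def linearPart : Motion →* Orth where
  toFun g := g.linearIsometryEquiv
  map_one' := rfl
  map_mul' _ _ := rfl

/-- The integer lattice in the plane. -/
def intLattice : AddSubgroup Plane where
  carrier := {v | ∀ i, ∃ n : ℤ, v i = n}
  zero_mem' := fun _ => ⟨0, by simp⟩
  add_mem' := by
    intro a b ha hb i
    obtain ⟨m, hm⟩ := ha i
    obtain ⟨n, hn⟩ := hb i
    exact ⟨m + n, by simp [hm, hn]⟩
  neg_mem' := by
    intro a ha i
    obtain ⟨m, hm⟩ := ha i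
    exact ⟨-m, by simp [hm]⟩

theorem motion_apply (g : Motion) (x : Plane) : g x = linearPart g x + g 0 := by
  have h := g.map_vadd 0 x
  rw [vadd_eq_add, vadd_eq_add, add_zero] at h
  exact h

/-- The semidirect product of the integer lattice with a group `F` of orthogonal transformations
that preserve it: all motions `x ↦ γ x + v` with `γ ∈ F` and `v` in the lattice. -/
def latticeSemidirect (F : Subgroup Orth) (hF : ∀ γ ∈ F, ∀ v ∈ intLattice, γ v ∈ intLattice) :
    Subgroup Motion where
  carrier := {g | linearPart g ∈ F ∧ g 0 ∈ intLattice}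
  one_mem' := ⟨by rw [map_one]; exact F.one_mem, intLattice.zero_mem⟩
  mul_mem' := by
    rintro g h ⟨hg, hg0⟩ ⟨hh, hh0⟩
    refine ⟨by rw [map_mul]; exact F.mul_mem hg hh, ?_⟩
    change g (h 0) ∈ intLattice
    rw [motion_apply g]
    exact intLattice.add_mem (hF _ hg _ hh0) hg0
  inv_mem' := by
    rintro g ⟨hg, hg0⟩
    have hi : linearPart g⁻¹ ∈ F := by rw [map_inv]; exact F.inv_mem hg
    refine ⟨hi, ?_⟩
    have h : g⁻¹ (g 0) = 0 := g.symm_apply_apply 0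
    rw [motion_apply g⁻¹] at h
    rw [eq_neg_of_add_eq_zero_right h]
    exact intLattice.neg_mem (hF _ hi _ hg0)

/-- The underlying topological space of the orbifold `G \ ℝ²`. -/
abbrev Underlying (G : Subgroup Motion) : Type := Quotient (MulAction.orbitRel G Plane)

/-- The image in `G \ ℝ²` of a point of the plane. -/
def proj (G : Subgroup Motion) (x : Plane) : Underlying G := Quotient.mk _ x

/-! ### Isotropy -/

/-- Rotation about the origin through the angle `θ`. -/
def rotation (θ : ℝ) : Orth :=
  LinearIsometryEquiv.mk
    { toFun := fun x => !₂[Real.cos θ * x 0 - Real.sin θ * x 1, Real.sin θ * x 0 + Real.cos θ * x 1]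
      invFun := fun x =>
        !₂[Real.cos θ * x 0 + Real.sin θ * x 1, -Real.sin θ * x 0 + Real.cos θ * x 1]
      map_add' := by
        intro x y
        ext i
        fin_cases i <;> simp <;> ring
      map_smul' := by
        intro c x
        ext i
        fin_cases i <;> simp <;> ring
      left_inv := by
        intro x
        ext i
        fin_cases i
        · simp
          linear_combination (x 0) * Real.sin_sq_add_cos_sq θ
        · simp
          linear_combination (x 1) * Real.sin_sq_add_cos_sq θ
      right_inv := by
        intro x
        ext i
        fin_cases i
        · simp
          linear_combination (x 0) * Real.sin_sq_add_cos_sq θ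
        · simp
          linear_combination (x 1) * Real.sin_sq_add_cos_sq θ }
    (by
      intro x
      simp only [EuclideanSpace.norm_eq, Fin.sum_univ_two, Real.norm_eq_abs, sq_abs]
      congr 1
      simp
      linear_combination (x 0 ^ 2 + x 1 ^ 2) * Real.sin_sq_add_cos_sq θ)

/-- Reflection across the line through the origin that makes the angle `θ` with the `x`-axis. -/
def lineReflection (θ : ℝ) : Orth :=
  (Submodule.span ℝ {(!₂[Real.cos θ, Real.sin θ] : Plane)}).reflection

/-- The isotropy group of the image of `x` in `G \ ℝ²`, viewed inside the orthogonal group through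
the derivatives at `x` of the elements of the stabilizer of `x`. -/
def isotropy (G : Subgroup Motion) (x : Plane) : Subgroup Orth :=
  (G ⊓ MulAction.stabilizer Motion x).map linearPart

/-- The image of `x` in `G \ ℝ²` has the isotropy type (conjugacy class in the orthogonal group)
of `H`. -/
def HasIsotropyType (G : Subgroup Motion) (x : Plane) (H : Subgroup Orth) : Prop :=
  ∃ h : Orth, isotropy G x = H.map (MulAut.conj h).toMonoidHom

/-- The image of `x` in `G \ ℝ²` is a singular point. -/
def IsSingular (G : Subgroup Motion) (x : Plane) : Prop := isotropy G x ≠ ⊥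

/-- The image of `x` in `G \ ℝ²` is a cone point of order `k`. -/
def IsConePoint (G : Subgroup Motion) (k : ℕ) (x : Plane) : Prop :=
  2 ≤ k ∧ HasIsotropyType G x (Subgroup.zpowers (rotation (2 * Real.pi / k)))

/-- The image of `x` in `G \ ℝ²` lies on a reflector edge (a mirror). -/
def IsReflectorPoint (G : Subgroup Motion) (x : Plane) : Prop :=
  HasIsotropyType G x (Subgroup.zpowers (lineReflection 0))

/-- The image of `x` in `G \ ℝ²` is a dihedral point (a corner reflector): the isotropy group is
generated by reflections across two lines that form the angle `π / k`. -/
def IsDihedralPoint (G : Subgroup Motion) (k : ℕ) (x : Plane) : Prop :=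
  2 ≤ k ∧ HasIsotropyType G x
    (Subgroup.closure {lineReflection 0, lineReflection (Real.pi / k)})

/-! ### Differential forms and the Hodge Laplacian -/

/-- Differential `p`-forms on the plane (without any regularity). -/
abbrev Form (p : ℕ) : Type := Plane → Plane [⋀^Fin p]→L[ℝ] ℝ

/-- The standard orthonormal frame. -/
def frame (i : Fin 2) : Plane := EuclideanSpace.single i 1

/-- Pullback of a form by a Euclidean motion. -/
def pullback {p : ℕ} (g : Motion) (ω : Form p) : Form p := fun x =>
  (ω (g x)).compContinuousLinearMap (g.linearIsometryEquiv : Plane →L[ℝ] Plane)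

/-- The codifferential `δ` of the flat metric, `δω = - ∑ᵢ ι(eᵢ) ∇_{eᵢ} ω`. -/
def codiff {p : ℕ} (ω : Form (p + 1)) : Form p := fun x =>
  -∑ i, (fderiv ℝ ω x (frame i)).curryLeft (frame i)

/-- The (nonnegative) Hodge Laplacian `dδ + δd`; on functions `δ` vanishes. -/
def hodgeLaplacian : {p : ℕ} → Form p → Form p
  | 0, ω => codiff (extDeriv ω)
  | _ + 1, ω => fun x => extDeriv (codiff ω) x + codiff (extDeriv ω) x

/-- The pointwise inner product of `p`-forms, for which the `dx^J` with increasing multi-indices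
`J` are orthonormal. -/
def formInner {p : ℕ} (a b : Plane [⋀^Fin p]→L[ℝ] ℝ) : ℝ :=
  (p.factorial : ℝ)⁻¹ * ∑ J : Fin p → Fin 2, a (fun k => frame (J k)) * b (fun k => frame (J k))

/-! ### Spectra -/

/-- `lam 0 ≤ lam 1 ≤ ⋯ → ∞` is the list of eigenvalues, repeated according to multiplicity, for the
eigenvalue problem on `D` whose smooth eigenforms with eigenvalue `μ` are the elements of `Eig μ`:
there are eigenforms with these eigenvalues that form an orthonormal basis of the Hilbert space of
square-integrable `p`-forms on `D`. -/
def IsEigenvalueList {p : ℕ} (D : Set Plane) (Eig : ℝ → Set (Form p)) (lam : ℕ → ℝ) : Prop :=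
  (∀ i, 0 ≤ lam i) ∧ Monotone lam ∧ Tendsto lam atTop atTop ∧
  ∃ φ : ℕ → Form p,
    (∀ i, φ i ∈ Eig (lam i)) ∧
    (∀ i, MemLp (φ i) 2 (volume.restrict D)) ∧
    (∀ i j, ∫ x in D, formInner (φ i x) (φ j x) = if i = j then 1 else 0) ∧
    ∀ ω : Form p, MemLp ω 2 (volume.restrict D) →
      (∀ i, ∫ x in D, formInner (ω x) (φ i x) = 0) → ω =ᵐ[volume.restrict D] 0

/-- The smooth eigenforms with eigenvalue `μ` of the Hodge Laplacian on `p`-forms of the orbifold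
`G \ ℝ²`, identified with their lifts to `ℝ²`. -/
def orbifoldEigenforms (p : ℕ) (G : Subgroup Motion) (μ : ℝ) : Set (Form p) :=
  {ω | ContDiff ℝ ((⊤ : ℕ∞) : WithTop ℕ∞) ω ∧ (∀ g ∈ G, pullback g ω = ω) ∧ ∀ x, hodgeLaplacian ω x = μ • ω x}

/-- `lam` is the `p`-spectrum of the orbifold `G \ ℝ²`. Square-integrable forms on the orbifold are
square-integrable forms on a fundamental domain `D` of `G`. -/
def IsOrbifoldSpectrum (p : ℕ) (G : Subgroup Motion) (lam : ℕ → ℝ) : Prop :=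
  ∃ D : Set Plane, IsFundamentalDomain G D ∧ IsEigenvalueList D (orbifoldEigenforms p G) lam

/-- The closed square `[0, 1/2] × [0, 1/2]`. -/
def square : Set Plane := {x | ∀ i, 0 ≤ x i ∧ x i ≤ 1 / 2}

/-- `x` lies on one of the two edges of the square that are orthogonal to `frame i`. -/
def OnEdge (i : Fin 2) (x : Plane) : Prop := x ∈ square ∧ (x i = 0 ∨ x i = 1 / 2)

/-- The pullback `j^* ι_ν a` to an edge orthogonal to the unit vector `ν` of the contraction
of `a` with `ν`. -/
def normalPart {p : ℕ} (ν : Plane) (a : Plane [⋀^Fin (p + 1)]→L[ℝ] ℝ) :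
    (Submodule.span ℝ {ν})ᗮ [⋀^Fin p]→L[ℝ] ℝ :=
  (a.curryLeft ν).compContinuousLinearMap (Submodule.span ℝ {ν})ᗮ.subtypeL

/-- The absolute boundary conditions `j^* ι_ν ω = j^* ι_ν dω = 0` on the edges of the square
(for functions the first one is void). -/
def AbsoluteBoundary : {p : ℕ} → Form p → Prop
  | 0, ω => ∀ i x, OnEdge i x → normalPart (frame i) (extDeriv ω x) = 0
  | _ + 1, ω => ∀ i x, OnEdge i x →
      normalPart (frame i) (ω x) = 0 ∧ normalPart (frame i) (extDeriv ω x) = 0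

/-- The eigenforms with eigenvalue `μ` of the Hodge Laplacian on `p`-forms of the closed square with
absolute boundary conditions. Forms that are smooth up to the boundary are given by a smooth
extension to the plane; only the restriction to the square matters. -/
def squareEigenforms (p : ℕ) (μ : ℝ) : Set (Form p) :=
  {ω | ContDiff ℝ ((⊤ : ℕ∞) : WithTop ℕ∞) ω ∧ AbsoluteBoundary ω ∧ ∀ x ∈ square, hodgeLaplacian ω x = μ • ω x}

/-- `lam` is the `p`-spectrum of the square with absolute boundary conditions. -/
def IsSquareAbsoluteSpectrum (p : ℕ) (lam : ℕ → ℝ) : Prop :=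
  IsEigenvalueList square (squareEigenforms p) lam

/-! ### The two orbifolds -/

/-- The group generated by the rotation about the origin through `π / 2`. -/
def rotGroup : Subgroup Orth := Subgroup.zpowers (rotation (Real.pi / 2))

/-- The group generated by the reflections across the `x`-axis and the `y`-axis. -/
def kleinGroup : Subgroup Orth :=
  Subgroup.closure {(Submodule.span ℝ {frame 0}).reflection,
    (Submodule.span ℝ {frame 1}).reflection}

theorem rotGroup_preserves : ∀ γ ∈ rotGroup, ∀ v ∈ intLattice, γ v ∈ intLattice := by
  intro γ hγ
  rw [rotGroup, Subgroup.zpowers_eq_closure] at hγ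
  have key : ∀ v : Plane, rotation (Real.pi / 2) v = !₂[-v 1, v 0] := by
    intro v
    ext i
    fin_cases i <;> simp [rotation]
  have keyi : ∀ v : Plane, (rotation (Real.pi / 2))⁻¹ v = !₂[v 1, -v 0] := by
    intro v
    apply (rotation (Real.pi / 2)).injective
    change rotation (Real.pi / 2) ((rotation (Real.pi / 2)).symm v) = _
    rw [LinearIsometryEquiv.apply_symm_apply, key]
    ext i
    fin_cases i <;> simp
  refine Subgroup.closure_induction'' (p := fun γ _ => ∀ v ∈ intLattice, γ v ∈ intLattice)
    ?_ ?_ ?_ ?_ hγ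
  · intro x hx v hv i
    rw [Set.mem_singleton_iff] at hx
    subst hx
    rw [key]
    obtain ⟨m, hm⟩ := hv 0
    obtain ⟨n, hn⟩ := hv 1
    fin_cases i
    · exact ⟨-n, by simp [hn]⟩
    · exact ⟨m, by simp [hm]⟩
  · intro x hx v hv i
    rw [Set.mem_singleton_iff] at hx
    subst hx
    rw [keyi]
    obtain ⟨m, hm⟩ := hv 0
    obtain ⟨n, hn⟩ := hv 1
    fin_cases i
    · exact ⟨n, by simp [hn]⟩
    · exact ⟨-m, by simp [hm]⟩
  · intro v hv
    exact hv
  · intro x y _ _ hx hy v hv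
    exact hx _ (hy v hv)

theorem kleinGroup_preserves : ∀ γ ∈ kleinGroup, ∀ v ∈ intLattice, γ v ∈ intLattice := by
  intro γ hγ
  have key : ∀ j : Fin 2, ∀ v ∈ intLattice,
      (Submodule.span ℝ {frame j}).reflection v ∈ intLattice := by
    intro j v hv i
    rw [Submodule.reflection_singleton_apply]
    obtain ⟨m, hm⟩ := hv i
    obtain ⟨n, hn⟩ := hv j
    by_cases hij : i = j
    · subst hij
      exact ⟨m, by simp [frame, hm, EuclideanSpace.inner_single_left]; ring⟩
    · exact ⟨-m, by simp [frame, hm, hij, EuclideanSpace.inner_single_left]⟩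
  refine Subgroup.closure_induction'' (p := fun γ _ => ∀ v ∈ intLattice, γ v ∈ intLattice)
    ?_ ?_ ?_ ?_ hγ
  · rintro x (rfl | rfl)
    · exact key 0
    · exact key 1
  · rintro x (rfl | rfl)
    · rw [Submodule.reflection_inv]
      exact key 0
    · rw [Submodule.reflection_inv]
      exact key 1
  · intro v hv
    exact hv
  · intro x y _ _ hx hy v hv
    exact hx _ (hy v hv)

/-- The crystallographic group `ℤ² ⋊ C₄`. -/
def pillowGroup : Subgroup Motion := latticeSemidirect rotGroup rotGroup_preserves

/-- The crystallographic group `ℤ² ⋊ V₄`. -/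
def squareGroup : Subgroup Motion := latticeSemidirect kleinGroup kleinGroup_preserves

end FlatOrbifold

end

noncomputable section

namespace FlatOrbifold

open MeasureTheory Filter

/-! ### Motions with lattice translation part -/

/-! Local structure. A motion with linear part `γ` fixes `x` only if its translation part is `x - γ
x`. Isotropy and orbit equivalence under a lattice semidirect product thus become integrality
conditions on `x - γ x` and `x - γ y` (`mem_isotropy`, `proj_eq_iff`), to be checked for the four
elements of each holonomy group.

The square as a quotient. The Klein group acts by a sign on each coordinate, so the question
decouples into folding the line onto `[0, 1/2]`. Folding does not increase distances, which gives
the metric inequality `dist_le_dist_squareGroup`. That inequality yields injectivity of the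
projection on the square and also the fundamental domain property.

The sphere. The cosines `cos 2πx`, `cos 2πy` determine a point up to signs and lattice translations,
so their maximum `u` and minimum `v` parametrize the quotient by the group enlarged by all
symmetries of the square. This quotient is the triangle `-1 ≤ v ≤ u ≤ 1`, and the pillow is its
double. The sign of `sin 2πx sin 2πy (cos 2πx - cos 2πy)` separates the two sheets and the product
vanishes exactly over the sides of the triangle (`orientationSign_eq_zero_iff`). Lifting the sheets
to plus and minus a minimum of three affine functions vanishing on the sides makes the double the
frontier of a convex body, hence a sphere.

The spectrum. The closed square is a fundamental domain of both groups, so all three eigenvalue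
problems live in the same `L²` space. The scalar functions `S = sin 2πmx cos 2πny` and `T = cos 2πnx
sin 2πmy`, with `m ≥ 1` and `n ≥ 0`, have the same eigenvalue `4π²(m² + n²)`. Up to normalization,
the forms `S dx` and `T dy` serve both the second orbifold and the square with absolute boundary
conditions. The forms `S dx + T dy` and `T dx - S dy` are invariant under the quarter turn and serve
the pillow. Each pair `(m, n)` contributes two forms in every case, whence the common spectrum.

Completeness rests on one scalar statement, `ae_eq_zero_of_orthogonal_sinCos`, proved by
Stone–Weierstrass; exchanging the coordinates reduces the other cases to it. -/

theorem mem_intLattice {v : Plane} :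
    v ∈ intLattice ↔ (∃ m : ℤ, v 0 = m) ∧ ∃ n : ℤ, v 1 = n :=
  ⟨fun h => ⟨h 0, h 1⟩, fun h i => by fin_cases i; exacts [h.1, h.2]⟩

theorem plane_ext {x y : Plane} (h0 : x 0 = y 0) (h1 : x 1 = y 1) : x = y := by
  ext i
  fin_cases i
  exacts [h0, h1]

theorem orth_mul_apply (γ δ : Orth) (x : Plane) : (γ * δ) x = γ (δ x) := rfl

theorem motion_ext {g h : Motion} (hl : linearPart g = linearPart h) (h0 : g 0 = h 0) : g = h := by
  ext1 x
  rw [motion_apply g, motion_apply h, hl, h0]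

/-- The motion `x ↦ γ x + v`. -/
def motionOf (γ : Orth) (v : Plane) : Motion :=
  AffineIsometryEquiv.constVAdd ℝ Plane v * γ.toAffineIsometryEquiv

theorem motionOf_apply (γ : Orth) (v x : Plane) : motionOf γ v x = γ x + v := by
  change v +ᵥ γ x = _
  rw [vadd_eq_add, add_comm]

theorem linearPart_motionOf (γ : Orth) (v : Plane) : linearPart (motionOf γ v) = γ := by
  ext1 x
  have h := motion_apply (motionOf γ v) x
  rw [motionOf_apply, motionOf_apply, map_zero, zero_add] at h
  exact (add_right_cancel h).symm

section LatticeSemidirect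

variable {F : Subgroup Orth} {hF : ∀ γ ∈ F, ∀ v ∈ intLattice, γ v ∈ intLattice}

theorem motionOf_mem {γ : Orth} (hγ : γ ∈ F) {v : Plane} (hv : v ∈ intLattice) :
    motionOf γ v ∈ latticeSemidirect F hF := by
  refine ⟨by rwa [linearPart_motionOf], ?_⟩
  rwa [motionOf_apply, map_zero, zero_add]

/-- The only motion with linear part `γ` that fixes `x` has translation part `x - γ x`, so what
remains is whether this vector is integral. -/
theorem mem_isotropy {x : Plane} {γ : Orth} :
    γ ∈ isotropy (latticeSemidirect F hF) x ↔ γ ∈ F ∧ x - γ x ∈ intLattice := by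
  constructor
  · rintro ⟨g, ⟨hg, hx⟩, rfl⟩
    refine ⟨hg.1, ?_⟩
    have hx : g x = x := hx
    rw [motion_apply] at hx
    rw [← eq_sub_iff_add_eq'.2 hx]
    exact hg.2
  · rintro ⟨hγ, hx⟩
    refine ⟨motionOf γ (x - γ x), ⟨motionOf_mem hγ hx, ?_⟩, linearPart_motionOf _ _⟩
    change motionOf γ (x - γ x) x = x
    rw [motionOf_apply, add_sub_cancel]

theorem proj_eq_iff_exists_motion {G : Subgroup Motion} {x y : Plane} :
    proj G x = proj G y ↔ ∃ g ∈ G, g y = x := by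
  rw [proj, proj, Quotient.eq]
  exact ⟨fun ⟨g, hg⟩ => ⟨g, g.2, hg⟩, fun ⟨g, hg, h⟩ => ⟨⟨g, hg⟩, h⟩⟩

theorem proj_eq_iff {x y : Plane} :
    proj (latticeSemidirect F hF) x = proj (latticeSemidirect F hF) y ↔
      ∃ γ ∈ F, x - γ y ∈ intLattice := by
  rw [proj_eq_iff_exists_motion]
  constructor
  · rintro ⟨g, hg, rfl⟩
    refine ⟨linearPart g, hg.1, ?_⟩
    rw [motion_apply g, add_sub_cancel_left]
    exact hg.2
  · rintro ⟨γ, hγ, h⟩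
    exact ⟨_, motionOf_mem hγ h, by rw [motionOf_apply, add_sub_cancel]⟩

theorem finite_intLattice_norm_le (R : ℝ) : {v : Plane | v ∈ intLattice ∧ ‖v‖ ≤ R}.Finite := by
  have hfin : (Set.Icc (-⌈R⌉) ⌈R⌉ ×ˢ Set.Icc (-⌈R⌉) ⌈R⌉ : Set (ℤ × ℤ)).Finite :=
    (Set.finite_Icc _ _).prod (Set.finite_Icc _ _)
  refine (hfin.image fun p : ℤ × ℤ => (!₂[(p.1 : ℝ), (p.2 : ℝ)] : Plane)).subset ?_
  rintro v ⟨hv, hR⟩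
  obtain ⟨⟨m, hm⟩, n, hn⟩ := mem_intLattice.1 hv
  have hb : ∀ i : Fin 2, ∀ k : ℤ, v i = k → k ∈ Set.Icc (-⌈R⌉) ⌈R⌉ := by
    intro i k hk
    have h1 : |v i| ≤ ⌈R⌉ := ((PiLp.norm_apply_le v i).trans hR).trans (Int.le_ceil R)
    rw [hk, ← Int.cast_abs, Int.cast_le] at h1
    exact abs_le.1 h1
  refine ⟨(m, n), ⟨hb 0 m hm, hb 1 n hn⟩, ?_⟩
  apply plane_ext <;> simp [hm, hn]

/-- A motion is determined by its linear part and the image of the origin. If it carries a point of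
`K` into `L`, that image is a lattice vector of norm at most `a + b`, so only finitely many pairs
occur. -/
theorem properlyDiscontinuousSMul_latticeSemidirect (hfin : (F : Set Orth).Finite) :
    ProperlyDiscontinuousSMul (latticeSemidirect F hF) Plane := by
  refine ⟨fun {K L} hK hL => ?_⟩
  obtain ⟨a, ha⟩ := hK.isBounded.exists_norm_le
  obtain ⟨b, hb⟩ := hL.isBounded.exists_norm_le
  have hinj : Function.Injective
      fun g : latticeSemidirect F hF => (linearPart (g : Motion), (g : Motion) 0) := by
    intro g h hgh
    exact Subtype.ext (motion_ext (congrArg Prod.fst hgh) (congrArg Prod.snd hgh))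
  refine ((hfin.prod (finite_intLattice_norm_le (a + b))).preimage hinj.injOn).subset ?_
  rintro g ⟨_, ⟨x, hx, rfl⟩, hgx⟩
  refine ⟨g.2.1, g.2.2, ?_⟩
  have h1 : ‖(g : Motion) x‖ ≤ b := hb _ hgx
  have h2 : (g : Motion) 0 = (g : Motion) x - linearPart (g : Motion) x := by
    rw [motion_apply (g : Motion) x, add_sub_cancel_left]
  change ‖(g : Motion) 0‖ ≤ a + b
  rw [h2]
  refine (norm_sub_le _ _).trans ?_
  rw [LinearIsometryEquiv.norm_map]
  linarith [ha x hx]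

end LatticeSemidirect

/-! ### The two holonomy groups -/

/-- The rotation through a right angle. -/
def quarterTurn : Orth := rotation (Real.pi / 2)

theorem quarterTurn_apply (x : Plane) : quarterTurn x = !₂[-x 1, x 0] := by
  apply plane_ext <;> simp [quarterTurn, rotation]

theorem quarterTurn_sq_apply (x : Plane) : (quarterTurn ^ 2) x = !₂[-x 0, -x 1] := by
  rw [pow_two, orth_mul_apply, quarterTurn_apply, quarterTurn_apply]
  apply plane_ext <;> simp

theorem quarterTurn_cube_apply (x : Plane) : (quarterTurn ^ 3) x = !₂[x 1, -x 0] := by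
  rw [pow_succ', orth_mul_apply, quarterTurn_sq_apply, quarterTurn_apply]
  apply plane_ext <;> simp

theorem quarterTurn_pow_four : quarterTurn ^ 4 = 1 := by
  ext1 x
  rw [pow_succ', orth_mul_apply, quarterTurn_cube_apply, quarterTurn_apply]
  apply plane_ext <;> simp

theorem quarterTurn_sq_ne_one : quarterTurn ^ 2 ≠ 1 := by
  intro h
  have := congrArg (fun γ : Orth => γ (frame 0) 0) h
  simp [quarterTurn_sq_apply, frame] at this
  norm_num at this

theorem orderOf_quarterTurn : orderOf quarterTurn = 4 :=
  orderOf_eq_prime_pow (p := 2) (n := 1) (by simpa using quarterTurn_sq_ne_one)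
    (by simpa using quarterTurn_pow_four)

theorem rotation_pi : rotation Real.pi = quarterTurn ^ 2 := by
  ext1 x
  rw [quarterTurn_sq_apply]
  apply plane_ext <;> simp [rotation]

theorem mem_rotGroup {γ : Orth} :
    γ ∈ rotGroup ↔ γ = 1 ∨ γ = quarterTurn ∨ γ = quarterTurn ^ 2 ∨ γ = quarterTurn ^ 3 := by
  have hfin : IsOfFinOrder quarterTurn := isOfFinOrder_iff_pow_eq_one.2 ⟨4, by simp,
    quarterTurn_pow_four⟩
  classical
  change γ ∈ Subgroup.zpowers quarterTurn ↔ _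
  rw [← hfin.mem_powers_iff_mem_zpowers]
  rw [hfin.mem_powers_iff_mem_range_orderOf, orderOf_quarterTurn]
  simp [Finset.range_add_one]
  tauto

/-- The reflection across the axis spanned by `frame j`. -/
def axisReflection (j : Fin 2) : Orth := (Submodule.span ℝ {frame j}).reflection

theorem axisReflection_zero_apply (x : Plane) : axisReflection 0 x = !₂[x 0, -x 1] := by
  rw [axisReflection, Submodule.reflection_singleton_apply]
  apply plane_ext <;> simp [frame, EuclideanSpace.inner_single_left]; ring

theorem axisReflection_one_apply (x : Plane) : axisReflection 1 x = !₂[-x 0, x 1] := by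
  rw [axisReflection, Submodule.reflection_singleton_apply]
  apply plane_ext <;> simp [frame, EuclideanSpace.inner_single_left]; ring

theorem axisReflection_mul_self (j : Fin 2) : axisReflection j * axisReflection j = 1 := by
  simp [axisReflection]

theorem axisReflection_mul (x : Plane) :
    (axisReflection 0 * axisReflection 1) x = !₂[-x 0, -x 1] := by
  rw [orth_mul_apply, axisReflection_one_apply, axisReflection_zero_apply]
  apply plane_ext <;> simp

theorem axisReflection_comm :
    axisReflection 1 * axisReflection 0 = axisReflection 0 * axisReflection 1 := by
  ext1 x
  rw [axisReflection_mul, orth_mul_apply, axisReflection_zero_apply,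
    axisReflection_one_apply]
  apply plane_ext <;> simp

theorem mem_kleinGroup {γ : Orth} :
    γ ∈ kleinGroup ↔ γ = 1 ∨ γ = axisReflection 0 ∨ γ = axisReflection 1 ∨
      γ = axisReflection 0 * axisReflection 1 := by
  have h0 : axisReflection 0 ∈ kleinGroup := Subgroup.subset_closure (Or.inl rfl)
  have h1 : axisReflection 1 ∈ kleinGroup := Subgroup.subset_closure (Or.inr rfl)
  have ha := axisReflection_mul_self 0
  have hb := axisReflection_mul_self 1
  have hc := axisReflection_comm
  -- Left multiplication by a generator permutes the four listed elements; since the generators are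
  -- involutions, this also covers their inverses in the induction below.
  have key : ∀ j : Fin 2, ∀ γ : Orth,
      (γ = 1 ∨ γ = axisReflection 0 ∨ γ = axisReflection 1 ∨
        γ = axisReflection 0 * axisReflection 1) →
      (axisReflection j * γ = 1 ∨ axisReflection j * γ = axisReflection 0 ∨
        axisReflection j * γ = axisReflection 1 ∨
        axisReflection j * γ = axisReflection 0 * axisReflection 1) := by
    intro j γ h
    fin_cases j
    · rcases h with rfl | rfl | rfl | rfl
      · exact Or.inr (Or.inl (mul_one _))
      · exact Or.inl ha
      · exact Or.inr (Or.inr (Or.inr rfl))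
      · refine Or.inr (Or.inr (Or.inl ?_))
        change axisReflection 0 * (axisReflection 0 * axisReflection 1) = _
        rw [← mul_assoc, ha, one_mul]
    · rcases h with rfl | rfl | rfl | rfl
      · exact Or.inr (Or.inr (Or.inl (mul_one _)))
      · exact Or.inr (Or.inr (Or.inr hc))
      · exact Or.inl hb
      · refine Or.inr (Or.inl ?_)
        change axisReflection 1 * (axisReflection 0 * axisReflection 1) = _
        rw [← hc, ← mul_assoc, hb, one_mul]
  constructor
  · intro h
    refine Subgroup.closure_induction_left (p := fun γ _ => γ = 1 ∨ γ = axisReflection 0 ∨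
      γ = axisReflection 1 ∨ γ = axisReflection 0 * axisReflection 1) (Or.inl rfl) ?_ ?_ h
    · rintro x (rfl | rfl) y _ hy
      exacts [key 0 y hy, key 1 y hy]
    · rintro x (rfl | rfl) y _ hy <;> rw [Submodule.reflection_inv]
      exacts [key 0 y hy, key 1 y hy]
  · rintro (rfl | rfl | rfl | rfl)
    exacts [one_mem _, h0, h1, mul_mem h0 h1]

theorem finite_rotGroup : (rotGroup : Set Orth).Finite := by
  refine (Set.toFinite {1, quarterTurn, quarterTurn ^ 2, quarterTurn ^ 3}).subset ?_
  intro γ hγ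
  exact mem_rotGroup.1 hγ

theorem finite_kleinGroup : (kleinGroup : Set Orth).Finite := by
  refine (Set.toFinite
    {1, axisReflection 0, axisReflection 1, axisReflection 0 * axisReflection 1}).subset ?_
  intro γ hγ
  exact mem_kleinGroup.1 hγ

theorem card_rotGroup : Nat.card rotGroup = 4 := by
  rw [rotGroup, Nat.card_zpowers]
  exact orderOf_quarterTurn

theorem axisReflection_ne_one (j : Fin 2) : axisReflection j ≠ 1 := by
  intro h
  fin_cases j
  · have := congrArg (fun γ : Orth => γ (frame 1) 1) h
    simp [axisReflection_zero_apply, frame] at this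
    norm_num at this
  · have := congrArg (fun γ : Orth => γ (frame 0) 0) h
    simp [axisReflection_one_apply, frame] at this
    norm_num at this

theorem axisReflection_ne : axisReflection 0 ≠ axisReflection 1 := by
  intro h
  have := congrArg (fun γ : Orth => γ (frame 0) 0) h
  simp [axisReflection_zero_apply, axisReflection_one_apply, frame] at this
  norm_num at this

theorem isKleinFour_kleinGroup : IsKleinFour kleinGroup := by
  have hsq : ∀ γ ∈ kleinGroup, γ ^ 2 = 1 := by
    intro γ hγ
    rcases mem_kleinGroup.1 hγ with rfl | rfl | rfl | rfl
    · exact one_pow 2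
    · rw [pow_two, axisReflection_mul_self]
    · rw [pow_two, axisReflection_mul_self]
    · rw [pow_two]
      nth_rewrite 2 [← axisReflection_comm]
      rw [mul_assoc, ← mul_assoc (axisReflection 1), axisReflection_mul_self, one_mul,
        axisReflection_mul_self]
  have hne : axisReflection 0 * axisReflection 1 ≠ 1 := by
    intro h
    refine axisReflection_ne ?_
    rw [← mul_one (axisReflection 0), ← axisReflection_mul_self 1, ← mul_assoc, h, one_mul]
  refine ⟨?_, ?_⟩
  · have hset : (kleinGroup : Set Orth) =
        {1, axisReflection 0, axisReflection 1, axisReflection 0 * axisReflection 1} := by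
      ext γ
      exact mem_kleinGroup
    change Nat.card (kleinGroup : Set Orth) = 4
    have h0 := axisReflection_ne_one 0
    have h1 := axisReflection_ne_one 1
    rw [Nat.card_coe_set_eq, hset, Set.ncard_insert_of_notMem, Set.ncard_insert_of_notMem,
      Set.ncard_pair]
    · simpa using h0
    · simpa [axisReflection_ne] using h1
    · simp [h0.symm, h1.symm, hne.symm]
  · have hdvd : Monoid.exponent kleinGroup ∣ 2 :=
      Monoid.exponent_dvd_of_forall_pow_eq_one fun γ => Subtype.ext (hsq γ γ.2)
    refine ((Nat.dvd_prime Nat.prime_two).1 hdvd).resolve_left fun h => ?_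
    have hmem : axisReflection 0 ∈ kleinGroup := mem_kleinGroup.2 (by simp)
    have h1 := Monoid.pow_exponent_eq_one (⟨_, hmem⟩ : kleinGroup)
    rw [h, pow_one] at h1
    exact axisReflection_ne_one 0 (congrArg Subtype.val h1)

/-! ### Isotropy of the pillow -/

theorem hasIsotropyType_of_eq {G : Subgroup Motion} {x : Plane} {H : Subgroup Orth}
    (h : isotropy G x = H) : HasIsotropyType G x H := by
  refine ⟨1, ?_⟩
  rw [map_one, h]
  exact (Subgroup.map_id H).symm

theorem mem_zpowers_of_mul_self {G : Type*} [Group G] {a b : G} (h : a * a = 1) :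
    b ∈ Subgroup.zpowers a ↔ b = 1 ∨ b = a := by
  have h2 : a ^ (2 : ℤ) = 1 := by rw [zpow_two, h]
  constructor
  · rintro ⟨n, rfl⟩
    change a ^ n = 1 ∨ a ^ n = a
    rcases Int.even_or_odd' n with ⟨k, rfl | rfl⟩
    · exact Or.inl (by rw [zpow_mul, h2, one_zpow])
    · exact Or.inr (by rw [zpow_add, zpow_mul, h2, one_zpow, one_mul, zpow_one])
  · rintro (rfl | rfl)
    exacts [one_mem _, Subgroup.mem_zpowers _]

theorem ne_int_half {a : ℝ} (m : ℤ) (h : a = m) : 2 * a ≠ 1 := by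
  rintro h2
  rw [h] at h2
  have : 2 * m = 1 := by exact_mod_cast h2
  lia

/-- Every nontrivial subgroup of a cyclic group of order four contains the element of order two. A
point is therefore singular exactly when the half turn is in its isotropy, that is, when `x - (-x)`
is integral. -/
theorem isSingular_pillowGroup_iff {x : Plane} :
    IsSingular pillowGroup x ↔ (∃ m : ℤ, 2 * x 0 = m) ∧ ∃ n : ℤ, 2 * x 1 = n := by
  have hsq : quarterTurn ^ 2 ∈ isotropy pillowGroup x ↔
      (∃ m : ℤ, 2 * x 0 = m) ∧ ∃ n : ℤ, 2 * x 1 = n := by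
    rw [pillowGroup, mem_isotropy, mem_intLattice, quarterTurn_sq_apply, mem_rotGroup]
    simp [two_mul]
  rw [← hsq, IsSingular]
  constructor
  · intro h
    obtain ⟨γ, hγ, hne⟩ := (Subgroup.bot_or_exists_ne_one _).resolve_left h
    rcases mem_rotGroup.1 (mem_isotropy.1 hγ).1 with rfl | rfl | rfl | rfl
    · exact absurd rfl hne
    · exact pow_mem hγ 2
    · exact hγ
    · have h6 := pow_mem hγ 2
      rwa [← pow_mul, show 3 * 2 = 4 + 2 from rfl, pow_add, quarterTurn_pow_four, one_mul] at h6
  · intro h hbot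
    rw [hbot, Subgroup.mem_bot] at h
    exact quarterTurn_sq_ne_one h

theorem isSingular_pillowGroup_iff_proj {x : Plane} :
    IsSingular pillowGroup x ↔
      proj pillowGroup x = proj pillowGroup !₂[0, 0] ∨
      proj pillowGroup x = proj pillowGroup !₂[1 / 2, 1 / 2] ∨
      proj pillowGroup x = proj pillowGroup !₂[1 / 2, 0] := by
  -- Being half-integral is a property of the orbit: `2x = 2(x - γ p) + γ(2p)`.
  have hdouble : ∀ p : Plane, p + p ∈ intLattice → proj pillowGroup x = proj pillowGroup p →
      (∃ m : ℤ, 2 * x 0 = m) ∧ ∃ n : ℤ, 2 * x 1 = n := by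
    intro p hp h
    obtain ⟨γ, hγ, hx⟩ := proj_eq_iff.1 h
    have h2 := intLattice.add_mem (intLattice.add_mem hx hx) (rotGroup_preserves γ hγ _ hp)
    have heq : x - γ p + (x - γ p) + γ (p + p) = x + x := by
      rw [map_add]
      abel
    rw [heq, mem_intLattice] at h2
    simpa [two_mul] using h2
  rw [isSingular_pillowGroup_iff]
  constructor
  · rintro ⟨⟨m, hm⟩, n, hn⟩
    simp only [pillowGroup, proj_eq_iff, mem_intLattice]
    rcases Int.even_or_odd' m with ⟨a, rfl | rfl⟩ <;> rcases Int.even_or_odd' n with ⟨b, rfl | rfl⟩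
    all_goals push_cast at hm hn
    · refine Or.inl ⟨1, one_mem _, ⟨a, ?_⟩, b, ?_⟩ <;> simp <;> linarith
    -- Here `x` is congruent to `(0, 1/2)`, the image of `(1/2, 0)` under the quarter turn. Of the
    -- four half-integral classes only these two are identified.
    · refine Or.inr (Or.inr ⟨quarterTurn, mem_rotGroup.2 (by simp), ⟨a, ?_⟩, b, ?_⟩) <;>
        rw [quarterTurn_apply] <;> simp <;> linarith
    · refine Or.inr (Or.inr ⟨1, one_mem _, ⟨a, ?_⟩, b, ?_⟩) <;> simp <;> linarith
    · refine Or.inr (Or.inl ⟨1, one_mem _, ⟨a, ?_⟩, b, ?_⟩) <;> simp <;> linarith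
  · rintro (h | h | h)
    · exact hdouble _ (mem_intLattice.2 ⟨⟨0, by simp⟩, 0, by simp⟩) h
    · exact hdouble _ (mem_intLattice.2 ⟨⟨1, by simp; norm_num⟩, 1, by simp; norm_num⟩) h
    · exact hdouble _ (mem_intLattice.2 ⟨⟨1, by simp; norm_num⟩, 0, by simp⟩) h

theorem proj_origin_ne_center : proj pillowGroup !₂[0, 0] ≠ proj pillowGroup !₂[1 / 2, 1 / 2] := by
  intro h
  obtain ⟨γ, hγ, hx⟩ := proj_eq_iff.1 h.symm
  have h0 : γ !₂[0, 0] = 0 := by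
    rw [show (!₂[0, 0] : Plane) = 0 by apply plane_ext <;> simp, map_zero]
  rw [h0, mem_intLattice] at hx
  obtain ⟨⟨m, hm⟩, -⟩ := hx
  exact ne_int_half m hm (by simp)

theorem proj_origin_ne_edge : proj pillowGroup !₂[0, 0] ≠ proj pillowGroup !₂[1 / 2, 0] := by
  intro h
  obtain ⟨γ, hγ, hx⟩ := proj_eq_iff.1 h.symm
  have h0 : γ !₂[0, 0] = 0 := by
    rw [show (!₂[0, 0] : Plane) = 0 by apply plane_ext <;> simp, map_zero]
  rw [h0, mem_intLattice] at hx
  obtain ⟨⟨m, hm⟩, -⟩ := hx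
  exact ne_int_half m hm (by simp)

/-- A rotation in the group takes `(1/2, 0)` to a point with exactly one zero coordinate; in that
coordinate the difference from the center is `1/2`. -/
theorem proj_center_ne_edge :
    proj pillowGroup !₂[1 / 2, 1 / 2] ≠ proj pillowGroup !₂[1 / 2, 0] := by
  intro h
  obtain ⟨γ, hγ, hx⟩ := proj_eq_iff.1 h
  rw [mem_intLattice] at hx
  obtain ⟨⟨m, hm⟩, n, hn⟩ := hx
  rcases mem_rotGroup.1 hγ with rfl | rfl | rfl | rfl
  · exact ne_int_half n hn (by simp)
  · exact ne_int_half m hm (by rw [quarterTurn_apply]; simp)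
  · exact ne_int_half n hn (by rw [quarterTurn_sq_apply]; simp)
  · exact ne_int_half m hm (by rw [quarterTurn_cube_apply]; simp)

theorem proj_edge_eq : proj pillowGroup !₂[1 / 2, 0] = proj pillowGroup !₂[0, 1 / 2] :=
  proj_eq_iff.2 ⟨quarterTurn ^ 3, mem_rotGroup.2 (by simp), mem_intLattice.2
    ⟨⟨0, by rw [quarterTurn_cube_apply]; simp⟩, 0, by rw [quarterTurn_cube_apply]; simp⟩⟩

theorem isConePoint_of_forall_sub_mem {x : Plane} (h : ∀ γ ∈ rotGroup, x - γ x ∈ intLattice) :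
    IsConePoint pillowGroup 4 x := by
  refine ⟨by norm_num, hasIsotropyType_of_eq ?_⟩
  rw [show 2 * Real.pi / (4 : ℕ) = Real.pi / 2 by push_cast; ring]
  ext γ
  exact mem_isotropy.trans ⟨fun h => h.1, fun hγ => ⟨hγ, h γ hγ⟩⟩

theorem isConePoint_origin : IsConePoint pillowGroup 4 !₂[0, 0] := by
  refine isConePoint_of_forall_sub_mem fun γ _ => ?_
  rw [show (!₂[0, 0] : Plane) = 0 by apply plane_ext <;> simp, map_zero, sub_zero]
  exact zero_mem _

theorem isConePoint_center : IsConePoint pillowGroup 4 !₂[1 / 2, 1 / 2] := by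
  refine isConePoint_of_forall_sub_mem fun γ hγ => mem_intLattice.2 ?_
  rcases mem_rotGroup.1 hγ with rfl | rfl | rfl | rfl
  · exact ⟨⟨0, by simp⟩, 0, by simp⟩
  · rw [quarterTurn_apply]
    exact ⟨⟨1, by simp; norm_num⟩, 0, by simp⟩
  · rw [quarterTurn_sq_apply]
    exact ⟨⟨1, by simp; norm_num⟩, 1, by simp; norm_num⟩
  · rw [quarterTurn_cube_apply]
    exact ⟨⟨0, by simp⟩, 1, by simp; norm_num⟩

/-- The half turn moves the point by a lattice vector, whereas the two rotations of order four move
it to `(0, ±1/2)`, which differs from it by `1/2` in the first coordinate. -/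
theorem isConePoint_edge : IsConePoint pillowGroup 2 !₂[1 / 2, 0] := by
  refine ⟨le_rfl, hasIsotropyType_of_eq ?_⟩
  rw [show 2 * Real.pi / (2 : ℕ) = Real.pi by push_cast; ring, rotation_pi]
  ext γ
  rw [mem_zpowers_of_mul_self (by rw [← pow_add, quarterTurn_pow_four]), pillowGroup, mem_isotropy,
    mem_intLattice]
  constructor
  · rintro ⟨hγ, ⟨m, hm⟩, n, hn⟩
    rcases mem_rotGroup.1 hγ with rfl | rfl | rfl | rfl
    · exact Or.inl rfl
    · exact absurd (by rw [quarterTurn_apply]; simp) (ne_int_half m hm)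
    · exact Or.inr rfl
    · exact absurd (by rw [quarterTurn_cube_apply]; simp) (ne_int_half m hm)
  · rintro (rfl | rfl)
    · exact ⟨one_mem _, ⟨0, by simp⟩, 0, by simp⟩
    · refine ⟨mem_rotGroup.2 (by simp), ?_⟩
      rw [quarterTurn_sq_apply]
      exact ⟨⟨1, by simp; norm_num⟩, 0, by simp⟩

/-! ### Isotropy of the square -/

/-- In the square `0 ≤ 2 xᵢ ≤ 1`, so integrality leaves only the endpoints. The right side is the
condition for negating coordinate `i` to fix `x` modulo the lattice. -/
theorem onEdge_iff {x : Plane} (hx : x ∈ square) (i : Fin 2) :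
    OnEdge i x ↔ ∃ m : ℤ, x i + x i = m := by
  constructor
  · rintro ⟨-, h | h⟩
    · exact ⟨0, by simp [h]⟩
    · exact ⟨1, by rw [h]; norm_num⟩
  · rintro ⟨m, hm⟩
    refine ⟨hx, ?_⟩
    obtain ⟨h0, h1⟩ := hx i
    have hm0 : 0 ≤ m := by
      have : (0 : ℝ) ≤ m := by linarith
      exact_mod_cast this
    have hm1 : m ≤ 1 := by
      have : (m : ℝ) ≤ 1 := by linarith
      exact_mod_cast this
    obtain rfl | rfl : m = 0 ∨ m = 1 := by lia
    · left
      push_cast at hm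
      linarith
    · right
      push_cast at hm
      linarith

/-- The indices cross over: `axisReflection 0` fixes the first axis and negates coordinate `1`, so
it is the edges orthogonal to `frame 1` that it stabilizes. -/
theorem mem_isotropy_squareGroup {x : Plane} (hx : x ∈ square) {γ : Orth} :
    γ ∈ isotropy squareGroup x ↔ γ = 1 ∨ (γ = axisReflection 0 ∧ OnEdge 1 x) ∨
      (γ = axisReflection 1 ∧ OnEdge 0 x) ∨
      (γ = axisReflection 0 * axisReflection 1 ∧ OnEdge 0 x ∧ OnEdge 1 x) := by
  have hz : ∃ m : ℤ, (0 : ℝ) = m := ⟨0, by simp⟩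
  rw [squareGroup, mem_isotropy, mem_kleinGroup, mem_intLattice, onEdge_iff hx, onEdge_iff hx]
  constructor
  · rintro ⟨rfl | rfl | rfl | rfl, h⟩
    · exact Or.inl rfl
    · exact Or.inr (Or.inl ⟨rfl, by simpa [axisReflection_zero_apply] using h.2⟩)
    · exact Or.inr (Or.inr (Or.inl ⟨rfl, by simpa [axisReflection_one_apply] using h.1⟩))
    · exact Or.inr (Or.inr (Or.inr ⟨rfl, by simpa [axisReflection_mul] using h⟩))
  · rintro (rfl | ⟨rfl, h⟩ | ⟨rfl, h⟩ | ⟨rfl, h⟩)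
    · exact ⟨Or.inl rfl, by simpa using hz⟩
    · exact ⟨by simp, by simpa [axisReflection_zero_apply] using ⟨hz, h⟩⟩
    · exact ⟨by simp, by simpa [axisReflection_one_apply] using ⟨h, hz⟩⟩
    · exact ⟨by simp, by simpa [axisReflection_mul] using h⟩

theorem lineReflection_eq_axisReflection {θ : ℝ} {j : Fin 2}
    (h : (!₂[Real.cos θ, Real.sin θ] : Plane) = frame j) :
    lineReflection θ = axisReflection j := by
  ext1 x
  rw [lineReflection, axisReflection, Submodule.reflection_singleton_apply,
    Submodule.reflection_singleton_apply, h]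

theorem lineReflection_zero : lineReflection 0 = axisReflection 0 :=
  lineReflection_eq_axisReflection (by apply plane_ext <;> simp [frame])

theorem lineReflection_pi_div_two : lineReflection (Real.pi / 2) = axisReflection 1 :=
  lineReflection_eq_axisReflection (by apply plane_ext <;> simp [frame])

theorem not_isSingular_squareGroup {x : Plane} (hx : x ∈ square) (h : ∀ i, ¬ OnEdge i x) :
    ¬ IsSingular squareGroup x := by
  rw [IsSingular, not_not, Subgroup.eq_bot_iff_forall]
  intro γ hγ
  rw [mem_isotropy_squareGroup hx] at hγ
  simpa [h 0, h 1] using hγ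

theorem conj_quarterTurn_axisReflection :
    MulAut.conj quarterTurn (axisReflection 0) = axisReflection 1 := by
  rw [MulAut.conj_apply, mul_inv_eq_iff_eq_mul]
  ext1 x
  rw [orth_mul_apply, orth_mul_apply, axisReflection_zero_apply, quarterTurn_apply,
    quarterTurn_apply, axisReflection_one_apply]
  apply plane_ext <;> simp

theorem isReflectorPoint_squareGroup {x : Plane} (hx : x ∈ square) (h : ∃! i, OnEdge i x) :
    IsReflectorPoint squareGroup x := by
  rw [IsReflectorPoint, lineReflection_zero]
  obtain ⟨i, hi, huniq⟩ := h
  fin_cases i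
  · have h1 : ¬ OnEdge 1 x := fun h => absurd (huniq 1 h) (by simp)
    -- On the edges orthogonal to `frame 0` the mirror is vertical, while the model reflection has a
    -- horizontal mirror; the quarter turn conjugates one into the other.
    refine ⟨quarterTurn, ?_⟩
    rw [MonoidHom.map_zpowers]
    ext γ
    change _ ↔ γ ∈ Subgroup.zpowers (MulAut.conj quarterTurn (axisReflection 0))
    have hi : OnEdge 0 x := hi
    rw [conj_quarterTurn_axisReflection, mem_zpowers_of_mul_self (axisReflection_mul_self 1),
      mem_isotropy_squareGroup hx]
    simp [h1, hi]
  · have h0 : ¬ OnEdge 0 x := fun h => absurd (huniq 0 h) (by simp)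
    refine hasIsotropyType_of_eq ?_
    ext γ
    have hi : OnEdge 1 x := hi
    rw [mem_zpowers_of_mul_self (axisReflection_mul_self 0), mem_isotropy_squareGroup hx]
    simp [h0, hi]

theorem isDihedralPoint_squareGroup {x : Plane} (hx : x ∈ square) (h : ∀ i, OnEdge i x) :
    IsDihedralPoint squareGroup 2 x := by
  refine ⟨le_rfl, hasIsotropyType_of_eq ?_⟩
  rw [Nat.cast_ofNat, lineReflection_zero, lineReflection_pi_div_two]
  ext γ
  rw [mem_isotropy_squareGroup hx]
  change _ ↔ γ ∈ kleinGroup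
  rw [mem_kleinGroup]
  simp [h 0, h 1]

/-! ### The square as a metric quotient -/

/-- Folding the line onto `[0, 1/2]` at the multiples of `1/2` does not increase distances; it fixes
`a` and takes `ε b + n` back to `b`. The verification distinguishes whether the image lies to the
left (`n < 0`), to the right (`n > 0`), or is `b` or `-b`. -/
theorem abs_sub_le_abs_sub_reflect {a b ε : ℝ} (ha0 : 0 ≤ a) (ha1 : a ≤ 1 / 2) (hb0 : 0 ≤ b)
    (hb1 : b ≤ 1 / 2) (hε : ε = 1 ∨ ε = -1) (n : ℤ) : |a - b| ≤ |a - (ε * b + n)| := by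
  rcases lt_trichotomy n 0 with hn | rfl | hn
  · have hn' : (n : ℝ) ≤ -1 := by exact_mod_cast Int.le_sub_one_of_lt hn
    have h := le_abs_self (a - (ε * b + n))
    refine abs_le.2 ⟨?_, ?_⟩ <;> rcases hε with rfl | rfl <;> linarith
  · rcases hε with rfl | rfl
    · simp
    · have h := le_abs_self (a - (-1 * b + (0 : ℤ)))
      push_cast at h ⊢
      refine abs_le.2 ⟨?_, ?_⟩ <;> linarith
  · have hn' : (1 : ℝ) ≤ n := by exact_mod_cast hn
    have h := neg_le_abs (a - (ε * b + n))
    refine abs_le.2 ⟨?_, ?_⟩ <;> rcases hε with rfl | rfl <;> linarith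

/-- The holonomy is diagonal, so each coordinate of `g x` depends only on the same coordinate of
`x`. This reduces the metric comparison to one dimension. -/
theorem exists_sign_of_mem_squareGroup {g : Motion} (hg : g ∈ squareGroup) (i : Fin 2) :
    ∃ ε : ℝ, (ε = 1 ∨ ε = -1) ∧ ∃ n : ℤ, ∀ x, g x i = ε * x i + n := by
  obtain ⟨n, hn⟩ := hg.2 i
  have hγ := mem_kleinGroup.1 hg.1
  have hx : ∀ x, g x i = linearPart g x i + n := fun x => by rw [motion_apply g, ← hn]; rfl
  rcases hγ with h | h | h | h <;> rw [h] at hx <;> fin_cases i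
  · exact ⟨1, by simp, n, fun x => by simpa using hx x⟩
  · exact ⟨1, by simp, n, fun x => by simpa using hx x⟩
  · exact ⟨1, by simp, n, fun x => by simpa [axisReflection_zero_apply] using hx x⟩
  · exact ⟨-1, by simp, n, fun x => by simpa [axisReflection_zero_apply] using hx x⟩
  · exact ⟨-1, by simp, n, fun x => by simpa [axisReflection_one_apply] using hx x⟩
  · exact ⟨1, by simp, n, fun x => by simpa [axisReflection_one_apply] using hx x⟩
  · exact ⟨-1, by simp, n, fun x => by simpa [axisReflection_mul] using hx x⟩
  · exact ⟨-1, by simp, n, fun x => by simpa [axisReflection_mul] using hx x⟩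

theorem dist_le_dist_squareGroup {x y : Plane} (hx : x ∈ square) (hy : y ∈ square) {g : Motion}
    (hg : g ∈ squareGroup) : dist x y ≤ dist x (g y) := by
  rw [EuclideanSpace.dist_eq, EuclideanSpace.dist_eq]
  refine Real.sqrt_le_sqrt (Finset.sum_le_sum fun i _ => ?_)
  obtain ⟨ε, hε, n, hn⟩ := exists_sign_of_mem_squareGroup hg i
  rw [hn, Real.dist_eq, Real.dist_eq]
  exact pow_le_pow_left₀ (abs_nonneg _)
    (abs_sub_le_abs_sub_reflect (hx i).1 (hx i).2 (hy i).1 (hy i).2 hε n) 2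

/-! ### The square meets every orbit -/

theorem isCompact_square : IsCompact square := by
  have h : square = (EuclideanSpace.equiv (Fin 2) ℝ) ⁻¹' Set.Icc (fun _ => 0) (fun _ => 1 / 2) := by
    ext x
    simp only [square, Set.mem_ofPred_eq, Set.mem_preimage, Set.mem_Icc, Pi.le_def]
    exact forall_and
  rw [h]
  exact (EuclideanSpace.equiv (Fin 2) ℝ).toHomeomorph.isCompact_preimage.2 isCompact_Icc

theorem exists_motion_mem_square {F : Subgroup Orth}
    {hF : ∀ γ ∈ F, ∀ v ∈ intLattice, γ v ∈ intLattice} {x : Plane} (γ : Orth) (hγ : γ ∈ F)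
    (p q : ℤ) (h0 : 0 ≤ γ x 0 + p) (h0' : γ x 0 + p ≤ 1 / 2) (h1 : 0 ≤ γ x 1 + q)
    (h1' : γ x 1 + q ≤ 1 / 2) : ∃ g ∈ latticeSemidirect F hF, g x ∈ square := by
  refine ⟨motionOf γ !₂[(p : ℝ), (q : ℝ)],
    motionOf_mem hγ (mem_intLattice.2 ⟨⟨p, by simp⟩, q, by simp⟩), ?_⟩
  rw [motionOf_apply]
  intro i
  fin_cases i
  exacts [⟨h0, h0'⟩, ⟨h1, h1'⟩]

theorem exists_mem_square_pillowGroup (x : Plane) : ∃ g ∈ pillowGroup, g x ∈ square := by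
  -- Subtracting the nearest integers leaves a point of `[-1/2, 1/2]²`. Its quadrant decides which
  -- rotation `γ` brings it to the first one, and the translation to use is then `-γ(m, n)`.
  set m := round (x 0)
  set n := round (x 1)
  have hm := abs_le.1 (abs_sub_round (x 0))
  have hn := abs_le.1 (abs_sub_round (x 1))
  rcases le_total 0 (x 0 - m) with h0 | h0 <;> rcases le_total 0 (x 1 - n) with h1 | h1
  · refine exists_motion_mem_square 1 (one_mem _) (-m) (-n) ?_ ?_ ?_ ?_ <;> simp <;> linarith
  · refine exists_motion_mem_square quarterTurn (mem_rotGroup.2 (by simp)) n (-m) ?_ ?_ ?_ ?_ <;>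
      simp [quarterTurn_apply] <;> linarith
  · refine exists_motion_mem_square (quarterTurn ^ 3) (mem_rotGroup.2 (by simp)) (-n) m ?_ ?_ ?_ ?_ <;>
      simp [quarterTurn_cube_apply] <;> linarith
  · refine exists_motion_mem_square (quarterTurn ^ 2) (mem_rotGroup.2 (by simp)) m n ?_ ?_ ?_ ?_ <;>
      simp [quarterTurn_sq_apply] <;> linarith

theorem exists_mem_square_squareGroup (x : Plane) : ∃ g ∈ squareGroup, g x ∈ square := by
  set m := round (x 0)
  set n := round (x 1)
  have hm := abs_le.1 (abs_sub_round (x 0))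
  have hn := abs_le.1 (abs_sub_round (x 1))
  rcases le_total 0 (x 0 - m) with h0 | h0 <;> rcases le_total 0 (x 1 - n) with h1 | h1
  · refine exists_motion_mem_square 1 (one_mem _) (-m) (-n) ?_ ?_ ?_ ?_ <;> simp <;> linarith
  · refine exists_motion_mem_square (axisReflection 0) (mem_kleinGroup.2 (by simp)) (-m) n ?_ ?_ ?_ ?_ <;>
      simp [axisReflection_zero_apply] <;> linarith
  · refine exists_motion_mem_square (axisReflection 1) (mem_kleinGroup.2 (by simp)) m (-n) ?_ ?_ ?_ ?_ <;>
      simp [axisReflection_one_apply] <;> linarith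
  · refine exists_motion_mem_square (axisReflection 0 * axisReflection 1) (mem_kleinGroup.2 (by simp)) m n
      ?_ ?_ ?_ ?_ <;> simp only [axisReflection_mul] <;> simp <;> linarith

/-! ### The square is homeomorphic to the second quotient -/

theorem continuous_proj (G : Subgroup Motion) : Continuous (proj G) := continuous_quotient_mk'

instance continuousConstSMul_motion (G : Subgroup Motion) : ContinuousConstSMul G Plane :=
  ⟨fun g => (g : Motion).continuous⟩

/-- A continuous bijection from a compact space to a Hausdorff space; proper discontinuity makes the
quotient Hausdorff. Injectivity is the metric inequality: if `x = g y`, then `dist x y ≤ dist x x`.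
-/
theorem isHomeomorph_square_proj : IsHomeomorph (fun x : square => proj squareGroup x) := by
  have := isCompact_iff_compactSpace.1 isCompact_square
  have : ProperlyDiscontinuousSMul squareGroup Plane :=
    properlyDiscontinuousSMul_latticeSemidirect finite_kleinGroup
  rw [isHomeomorph_iff_continuous_bijective]
  refine ⟨(continuous_proj _).comp continuous_subtype_val, ?_, ?_⟩
  · rintro ⟨x, hx⟩ ⟨y, hy⟩ h
    obtain ⟨g, hg, hgy⟩ := proj_eq_iff_exists_motion.1 h
    have hd := dist_le_dist_squareGroup hx hy hg
    rw [hgy, dist_self] at hd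
    exact Subtype.ext (dist_le_zero.1 hd)
  · intro q
    obtain ⟨x, rfl⟩ := Quotient.exists_rep q
    obtain ⟨g, hg, hgx⟩ := exists_mem_square_squareGroup x
    exact ⟨⟨g x, hgx⟩, proj_eq_iff_exists_motion.2 ⟨g, hg, rfl⟩⟩

theorem compactSpace_underlying_pillowGroup : CompactSpace (Underlying pillowGroup) := by
  refine ⟨(isCompact_square.image (continuous_proj pillowGroup)).of_isClosed_subset isClosed_univ
    fun q _ => ?_⟩
  obtain ⟨x, rfl⟩ := Quotient.exists_rep q
  obtain ⟨g, hg, hgx⟩ := exists_mem_square_pillowGroup x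
  exact ⟨g x, hgx, proj_eq_iff_exists_motion.2 ⟨g, hg, rfl⟩⟩

/-! ### The square is a fundamental domain of both groups -/

theorem ae_notMem_coord_eq (i : Fin 2) (c : ℝ) : volume {x : Plane | x i = c} = 0 := by
  have h := (EuclideanSpace.volume_preserving_symm_measurableEquiv_toLp (Fin 2)).measure_preimage
    (s := {y : Fin 2 → ℝ | y i = c}) (measurableSet_eq_fun (measurable_pi_apply i)
      measurable_const).nullMeasurableSet
  have h0 : volume {y : Fin 2 → ℝ | y i = c} = 0 := by
    have := Measure.pi_hyperplane (fun _ : Fin 2 => (volume : Measure ℝ)) i c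
    exact this
  rw [h0] at h
  exact h

theorem volume_onEdge (i : Fin 2) : volume {x : Plane | OnEdge i x} = 0 := by
  refine measure_mono_null (t := {x : Plane | x i = 0} ∪ {x | x i = 1 / 2}) ?_
    (measure_union_null (ae_notMem_coord_eq i 0) (ae_notMem_coord_eq i (1 / 2)))
  rintro x ⟨-, h⟩
  exact h

theorem measurePreserving_motion (g : Motion) : MeasurePreserving g volume volume := by
  have h := (measurePreserving_add_right volume (g 0)).comp (linearPart g).measurePreserving
  have hg : (fun x => x + g 0) ∘ linearPart g = g := funext fun x => (motion_apply g x).symm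
  rwa [hg] at h

open scoped Pointwise in
-- Translates of the square by nontrivial elements can overlap it only in points of its edges, which
-- form a null set.
theorem isFundamentalDomain_square {G : Subgroup Motion}
    (hcov : ∀ x : Plane, ∃ g ∈ G, g x ∈ square)
    (hint : ∀ x ∈ square, (∀ i, ¬ OnEdge i x) → ∀ g ∈ G, g x ∈ square → g = 1) :
    IsFundamentalDomain G square := by
  refine IsFundamentalDomain.mk'' isCompact_square.isClosed.measurableSet.nullMeasurableSet
    (Eventually.of_forall fun x => ?_) ?_ ?_
  · obtain ⟨g, hg, hx⟩ := hcov x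
    exact ⟨⟨g, hg⟩, hx⟩
  · intro g hg
    refine measure_mono_null (t := {x : Plane | OnEdge 0 x} ∪ {x | OnEdge 1 x}) ?_
      (measure_union_null (volume_onEdge 0) (volume_onEdge 1))
    rintro x ⟨hgx, hx⟩
    by_contra hne
    rw [Set.mem_union, not_or] at hne
    rw [Set.mem_smul_set_iff_inv_smul_mem] at hgx
    have h1 := hint x hx (fun i => by fin_cases i; exacts [hne.1, hne.2]) _ (g⁻¹).2 hgx
    exact hg (inv_eq_one.1 (Subtype.ext h1))
  · intro g
    exact (measurePreserving_motion (g : Motion)).quasiMeasurePreserving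

theorem isFundamentalDomain_square_squareGroup : IsFundamentalDomain squareGroup square := by
  refine isFundamentalDomain_square exists_mem_square_squareGroup fun x hx hi g hg hgx => ?_
  -- Applied to the points `g x` and `x` of the square, the inequality has right side `dist (g x) (g
  -- x)`, which forces `g` to fix `x`. The isotropy of an interior point is trivial.
  have hd := dist_le_dist_squareGroup hgx hx hg
  rw [dist_self] at hd
  have hfix : g x = x := dist_le_zero.1 hd
  have hl : linearPart g ∈ isotropy squareGroup x := ⟨g, ⟨hg, hfix⟩, rfl⟩
  rw [not_not.1 (not_isSingular_squareGroup hx hi), Subgroup.mem_bot] at hl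
  refine motion_ext (hl.trans (map_one linearPart).symm) ?_
  rw [motion_apply g, hl] at hfix
  exact add_eq_left.1 hfix

theorem int_eq_zero_of_add_mem {t : ℝ} (ht0 : 0 < t) (ht1 : t < 1 / 2) {m : ℤ} (h0 : 0 ≤ t + m)
    (h1 : t + m ≤ 1 / 2) : m = 0 := by
  have h2 : (-1 : ℝ) < m := by linarith
  have h3 : (m : ℝ) < 1 := by linarith
  have h2' : -1 < m := by exact_mod_cast h2
  have h3' : m < 1 := by exact_mod_cast h3
  lia

theorem not_neg_add_int_mem {t : ℝ} (ht0 : 0 < t) (ht1 : t < 1 / 2) {m : ℤ} (h0 : 0 ≤ -t + m)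
    (h1 : -t + m ≤ 1 / 2) : False := by
  have h2 : (0 : ℝ) < m := by linarith
  have h3 : (m : ℝ) < 1 := by linarith
  have h2' : 0 < m := by exact_mod_cast h2
  have h3' : m < 1 := by exact_mod_cast h3
  lia

/-- Each nontrivial rotation negates some coordinate, and `-t + m` with `0 < t < 1/2` never lies in
`[0, 1/2]`. With trivial rotation part, an integer translation that keeps an interior point in the
square is zero. -/
theorem isFundamentalDomain_square_pillowGroup : IsFundamentalDomain pillowGroup square := by
  refine isFundamentalDomain_square exists_mem_square_pillowGroup fun x hx hi g hg hgx => ?_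
  have hpos : ∀ i, 0 < x i ∧ x i < 1 / 2 := fun i =>
    ⟨lt_of_le_of_ne (hx i).1 fun h => hi i ⟨hx, Or.inl h.symm⟩,
      lt_of_le_of_ne (hx i).2 fun h => hi i ⟨hx, Or.inr h⟩⟩
  obtain ⟨⟨m, hm⟩, n, hn⟩ := mem_intLattice.1 hg.2
  have e0 : g x 0 = linearPart g x 0 + m := by rw [motion_apply g, ← hm]; rfl
  have e1 : g x 1 = linearPart g x 1 + n := by rw [motion_apply g, ← hn]; rfl
  have b0 := hgx 0
  have b1 := hgx 1
  rw [e0] at b0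
  rw [e1] at b1
  rcases mem_rotGroup.1 hg.1 with h | h | h | h <;> rw [h] at b0 b1
  · refine motion_ext (h.trans (map_one linearPart).symm) (plane_ext ?_ ?_)
    · rw [hm, int_eq_zero_of_add_mem (hpos 0).1 (hpos 0).2 b0.1 b0.2]
      exact Int.cast_zero
    · rw [hn, int_eq_zero_of_add_mem (hpos 1).1 (hpos 1).2 b1.1 b1.2]
      exact Int.cast_zero
  · rw [quarterTurn_apply] at b0
    exact (not_neg_add_int_mem (hpos 1).1 (hpos 1).2 b0.1 b0.2).elim
  · rw [quarterTurn_sq_apply] at b0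
    exact (not_neg_add_int_mem (hpos 0).1 (hpos 0).2 b0.1 b0.2).elim
  · rw [quarterTurn_cube_apply] at b1
    exact (not_neg_add_int_mem (hpos 0).1 (hpos 0).2 b1.1 b1.2).elim

/-! ### The first quotient is a sphere -/

/-- The function `cos (2 π ·)`. -/
def cosTwoPi (t : ℝ) : ℝ := Real.cos (2 * Real.pi * t)

/-- The function `sin (2 π ·)`. -/
def sinTwoPi (t : ℝ) : ℝ := Real.sin (2 * Real.pi * t)

theorem cosTwoPi_add_int (t : ℝ) (n : ℤ) : cosTwoPi (t + n) = cosTwoPi t := by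
  rw [cosTwoPi, mul_add, mul_comm _ (n : ℝ), Real.cos_add_int_mul_two_pi, cosTwoPi]

theorem sinTwoPi_add_int (t : ℝ) (n : ℤ) : sinTwoPi (t + n) = sinTwoPi t := by
  rw [sinTwoPi, mul_add, mul_comm _ (n : ℝ), Real.sin_add_int_mul_two_pi, sinTwoPi]

theorem cosTwoPi_neg (t : ℝ) : cosTwoPi (-t) = cosTwoPi t := by
  rw [cosTwoPi, mul_neg, Real.cos_neg, cosTwoPi]

theorem sinTwoPi_neg (t : ℝ) : sinTwoPi (-t) = -sinTwoPi t := by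
  rw [sinTwoPi, mul_neg, Real.sin_neg, sinTwoPi]

theorem continuous_cosTwoPi : Continuous cosTwoPi := by unfold cosTwoPi; fun_prop

theorem continuous_sinTwoPi : Continuous sinTwoPi := by unfold sinTwoPi; fun_prop

theorem cosTwoPi_le_one (t : ℝ) : cosTwoPi t ≤ 1 := Real.cos_le_one _

theorem neg_one_le_cosTwoPi (t : ℝ) : -1 ≤ cosTwoPi t := Real.neg_one_le_cos _

theorem sinTwoPi_eq_zero_iff (t : ℝ) : sinTwoPi t = 0 ↔ cosTwoPi t = 1 ∨ cosTwoPi t = -1 :=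
  Real.sin_eq_zero_iff_cos_eq

theorem exists_sign_of_cosTwoPi_eq {s t : ℝ} (h : cosTwoPi s = cosTwoPi t) :
    ∃ ε : ℝ, (ε = 1 ∨ ε = -1) ∧ ∃ n : ℤ, s = ε * t + n := by
  obtain ⟨k, hk⟩ := Real.cos_eq_cos_iff.1 h.symm
  have hpi : 2 * Real.pi ≠ 0 := by positivity
  rcases hk with hk | hk
  · exact ⟨1, Or.inl rfl, k, mul_left_cancel₀ hpi (by rw [hk]; ring)⟩
  · exact ⟨-1, Or.inr rfl, k, mul_left_cancel₀ hpi (by rw [hk]; ring)⟩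

theorem sinTwoPi_sign_mul {ε : ℝ} (hε : ε = 1 ∨ ε = -1) (t : ℝ) (n : ℤ) :
    sinTwoPi (ε * t + n) = ε * sinTwoPi t := by
  rw [sinTwoPi_add_int]
  rcases hε with rfl | rfl
  · simp
  · simp [sinTwoPi_neg]

theorem exists_two_mul_eq_int_of_sinTwoPi {t : ℝ} (h : sinTwoPi t = 0) : ∃ n : ℤ, 2 * t = n := by
  obtain ⟨n, hn⟩ := Real.sin_eq_zero_iff.1 h
  exact ⟨n, mul_left_cancel₀ Real.pi_ne_zero (by linear_combination -hn)⟩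

theorem cosTwoPi_arccos {u : ℝ} (h0 : -1 ≤ u) (h1 : u ≤ 1) :
    cosTwoPi (Real.arccos u / (2 * Real.pi)) = u := by
  rw [cosTwoPi, mul_div_cancel₀ _ (by positivity), Real.cos_arccos h0 h1]

theorem sinTwoPi_arccos_nonneg (u : ℝ) : 0 ≤ sinTwoPi (Real.arccos u / (2 * Real.pi)) := by
  rw [sinTwoPi, mul_div_cancel₀ _ (by positivity), Real.sin_arccos]
  exact Real.sqrt_nonneg _

/-! ### The pillow as a doubled triangle in three-space -/

/-- The height over the triangle `-1 ≤ v ≤ u ≤ 1` of the pillow. -/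
def pillowHeight (u v : ℝ) : ℝ := min (min (1 - u) (1 + v)) (u - v)

/-- A function on the plane that is invariant under the rotations and changes sign under the
reflections of the symmetry group of the square tiling. -/
def orientationSign (x : Plane) : ℝ :=
  sinTwoPi (x 0) * sinTwoPi (x 1) * (cosTwoPi (x 0) - cosTwoPi (x 1))

/-- The larger one of the two cosines. -/
def maxCos (x : Plane) : ℝ := max (cosTwoPi (x 0)) (cosTwoPi (x 1))

/-- The smaller one of the two cosines. -/
def minCos (x : Plane) : ℝ := min (cosTwoPi (x 0)) (cosTwoPi (x 1))

/-- The signed height of the pillow. -/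
def signedHeight (x : Plane) : ℝ :=
  if 0 ≤ orientationSign x then pillowHeight (maxCos x) (minCos x)
  else -pillowHeight (maxCos x) (minCos x)

theorem maxCos_le_one (x : Plane) : maxCos x ≤ 1 :=
  max_le (cosTwoPi_le_one _) (cosTwoPi_le_one _)

theorem neg_one_le_minCos (x : Plane) : -1 ≤ minCos x :=
  le_min (neg_one_le_cosTwoPi _) (neg_one_le_cosTwoPi _)

theorem minCos_le_maxCos (x : Plane) : minCos x ≤ maxCos x := min_le_max

theorem pillowHeight_nonneg {u v : ℝ} (h0 : u ≤ 1) (h1 : -1 ≤ v) (h2 : v ≤ u) :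
    0 ≤ pillowHeight u v :=
  le_min (le_min (by linarith) (by linarith)) (by linarith)

theorem pillowHeight_eq_zero_iff {u v : ℝ} (h0 : u ≤ 1) (h1 : -1 ≤ v) (h2 : v ≤ u) :
    pillowHeight u v = 0 ↔ u = 1 ∨ v = -1 ∨ u = v := by
  constructor
  · intro h
    unfold pillowHeight at h
    rcases min_choice (min (1 - u) (1 + v)) (u - v) with h' | h' <;> rw [h'] at h
    · rcases min_choice (1 - u) (1 + v) with h'' | h'' <;> rw [h''] at h
      · exact Or.inl (by linarith)
      · exact Or.inr (Or.inl (by linarith))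
    · exact Or.inr (Or.inr (by linarith))
  · intro h
    refine le_antisymm ?_ (pillowHeight_nonneg h0 h1 h2)
    unfold pillowHeight
    rcases h with rfl | rfl | rfl
    · exact (min_le_left _ _).trans ((min_le_left _ _).trans (by simp))
    · exact (min_le_left _ _).trans ((min_le_right _ _).trans (by simp))
    · exact (min_le_right _ _).trans (by simp)

/-- The factors match the sides of the triangle: a sine vanishes when its cosine is `1` or `-1`,
giving the sides `u = 1` and `v = -1`, and the difference of the cosines vanishes on `u = v`. -/
theorem orientationSign_eq_zero_iff (x : Plane) :
    orientationSign x = 0 ↔ pillowHeight (maxCos x) (minCos x) = 0 := by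
  rw [pillowHeight_eq_zero_iff (maxCos_le_one x) (neg_one_le_minCos x) (minCos_le_maxCos x),
    orientationSign, mul_eq_zero, mul_eq_zero, sinTwoPi_eq_zero_iff, sinTwoPi_eq_zero_iff,
    sub_eq_zero, maxCos, minCos]
  have a1 := cosTwoPi_le_one (x 0)
  have a2 := cosTwoPi_le_one (x 1)
  have b1 := neg_one_le_cosTwoPi (x 0)
  have b2 := neg_one_le_cosTwoPi (x 1)
  generalize cosTwoPi (x 0) = a at *
  generalize cosTwoPi (x 1) = b at *
  rcases le_total a b with h | h
  · rw [max_eq_right h, min_eq_left h]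
    grind
  · rw [max_eq_left h, min_eq_right h]
    grind

theorem continuous_maxCos : Continuous maxCos := by
  unfold maxCos
  exact (continuous_cosTwoPi.comp (by fun_prop)).max (continuous_cosTwoPi.comp (by fun_prop))

theorem continuous_minCos : Continuous minCos := by
  unfold minCos
  exact (continuous_cosTwoPi.comp (by fun_prop)).min (continuous_cosTwoPi.comp (by fun_prop))

theorem continuous_orientationSign : Continuous orientationSign := by
  unfold orientationSign
  have := continuous_cosTwoPi
  have := continuous_sinTwoPi
  fun_prop

theorem continuous_signedHeight : Continuous signedHeight := by
  have h : Continuous fun x => pillowHeight (maxCos x) (minCos x) := by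
    have := continuous_maxCos
    have := continuous_minCos
    unfold pillowHeight
    fun_prop
  -- The two branches agree where the orientation sign vanishes, because the height vanishes there
  -- too.
  refine Continuous.if_le h h.neg continuous_const continuous_orientationSign fun x hx => ?_
  rw [(orientationSign_eq_zero_iff x).1 hx.symm, neg_zero]

/-- The invariant map from the plane to three-space whose image is the boundary of a convex body. -/
def pillowMap (x : Plane) : EuclideanSpace ℝ (Fin 3) := !₂[maxCos x, minCos x, signedHeight x]

theorem continuous_pillowMap : Continuous pillowMap := by
  have := continuous_maxCos
  have := continuous_minCos
  have := continuous_signedHeight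
  refine (PiLp.continuous_toLp 2 _).comp (continuous_pi fun i => ?_)
  fin_cases i <;> assumption

theorem pillowMap_eq_iff {x y : Plane} : pillowMap x = pillowMap y ↔
    maxCos x = maxCos y ∧ minCos x = minCos y ∧ signedHeight x = signedHeight y := by
  constructor
  · intro h
    exact ⟨congrArg (fun p : EuclideanSpace ℝ (Fin 3) => p 0) h,
      congrArg (fun p : EuclideanSpace ℝ (Fin 3) => p 1) h,
      congrArg (fun p : EuclideanSpace ℝ (Fin 3) => p 2) h⟩
  · rintro ⟨h0, h1, h2⟩
    rw [pillowMap, pillowMap, h0, h1, h2]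

theorem signedHeight_congr {x y : Plane} (h0 : maxCos x = maxCos y) (h1 : minCos x = minCos y)
    (h2 : orientationSign x = orientationSign y) : signedHeight x = signedHeight y := by
  rw [signedHeight, signedHeight, h0, h1, h2]

/-- Opposite nonzero orientations would place the points on opposite sheets over the same point of
the triangle; equal signed heights then force height zero, that is, a point over a side. -/
theorem orientationSign_eq_zero_of_neg {x y : Plane} (h0 : maxCos x = maxCos y)
    (h1 : minCos x = minCos y) (h : signedHeight x = signedHeight y)
    (hJ : orientationSign x = -orientationSign y) : orientationSign y = 0 := by
  rw [orientationSign_eq_zero_iff]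
  by_contra hne
  have hJy := mt (orientationSign_eq_zero_iff y).1 hne
  rw [signedHeight, signedHeight, h0, h1, hJ] at h
  rcases lt_or_gt_of_ne hJy with hlt | hgt
  · rw [if_pos (by linarith), if_neg (by linarith)] at h
    exact hne (by linarith)
  · rw [if_neg (by linarith), if_pos (by linarith)] at h
    exact hne (by linarith)

theorem pillowMap_eq_of_proj_eq {x y : Plane} (h : proj pillowGroup x = proj pillowGroup y) :
    pillowMap x = pillowMap y := by
  obtain ⟨γ, hγ, hx⟩ := proj_eq_iff.1 h
  obtain ⟨⟨m, hm⟩, n, hn⟩ := mem_intLattice.1 hx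
  have e0 : x 0 = γ y 0 + m := by rw [← hm]; simp
  have e1 : x 1 = γ y 1 + n := by rw [← hn]; simp
  have key : maxCos x = maxCos y ∧ minCos x = minCos y ∧
      orientationSign x = orientationSign y := by
    unfold maxCos minCos orientationSign
    rw [e0, e1]
    simp only [cosTwoPi_add_int, sinTwoPi_add_int]
    rcases mem_rotGroup.1 hγ with rfl | rfl | rfl | rfl
    · simp
    -- A quarter turn exchanges the cosines and negates one sine. The two sign changes in the
    -- orientation product cancel.
    · rw [quarterTurn_apply]
      simp [cosTwoPi_neg, sinTwoPi_neg, max_comm, min_comm]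
      ring
    · rw [quarterTurn_sq_apply]
      simp [cosTwoPi_neg, sinTwoPi_neg]
    · rw [quarterTurn_cube_apply]
      simp [cosTwoPi_neg, sinTwoPi_neg, max_comm, min_comm]
      ring
  exact pillowMap_eq_iff.2 ⟨key.1, key.2.1, signedHeight_congr key.1 key.2.1 key.2.2⟩

theorem proj_eq_of_diagonal {x y : Plane} {ε δ : ℝ} (hε : ε = 1 ∨ ε = -1) (h : δ = ε) {m n : ℤ}
    (h0 : x 0 = ε * y 0 + m) (h1 : x 1 = δ * y 1 + n) :
    proj pillowGroup x = proj pillowGroup y := by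
  subst h
  rcases hε with rfl | rfl
  · exact proj_eq_iff.2 ⟨1, one_mem _, mem_intLattice.2
      ⟨⟨m, by simp [h0]⟩, n, by simp [h1]⟩⟩
  · refine proj_eq_iff.2 ⟨quarterTurn ^ 2, mem_rotGroup.2 (by simp), ?_⟩
    rw [quarterTurn_sq_apply]
    exact mem_intLattice.2 ⟨⟨m, by simp [h0]⟩, n, by simp [h1]⟩

theorem proj_eq_of_antidiagonal {x y : Plane} {ε δ : ℝ} (hε : ε = 1 ∨ ε = -1) (h : δ = -ε)
    {m n : ℤ} (h0 : x 0 = ε * y 1 + m) (h1 : x 1 = δ * y 0 + n) :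
    proj pillowGroup x = proj pillowGroup y := by
  subst h
  rcases hε with rfl | rfl
  · refine proj_eq_iff.2 ⟨quarterTurn ^ 3, mem_rotGroup.2 (by simp), ?_⟩
    rw [quarterTurn_cube_apply]
    exact mem_intLattice.2 ⟨⟨m, by simp [h0]⟩, n, by simp [h1]⟩
  · refine proj_eq_iff.2 ⟨quarterTurn, mem_rotGroup.2 (by simp), ?_⟩
    rw [quarterTurn_apply]
    exact mem_intLattice.2 ⟨⟨m, by simp [h0]⟩, n, by simp [h1]⟩

/-- If `2t` is an integer, then `t` and `-t` agree modulo the integers, so the sign can be chosen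
freely. -/
theorem flip_sign_of_two_mul_int {s t ε : ℝ} (hε : ε = 1 ∨ ε = -1) {m : ℤ} (h : s = ε * t + m)
    (ht : ∃ k : ℤ, 2 * t = k) : ∃ m' : ℤ, s = -ε * t + m' := by
  obtain ⟨k, hk⟩ := ht
  rcases hε with rfl | rfl
  · exact ⟨m + k, by push_cast; linarith⟩
  · exact ⟨m - k, by push_cast; linarith⟩

theorem sign_cases {ε δ : ℝ} (hε : ε = 1 ∨ ε = -1) (hδ : δ = 1 ∨ δ = -1) : δ = ε ∨ δ = -ε := by
  rcases hε with rfl | rfl <;> rcases hδ with rfl | rfl <;> norm_num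

/-- Equal maxima and minima give equal cosines up to order, so `x` arises from `y` by a signed
permutation of the coordinates and a lattice translation. If the permutation is a rotation, the
points are in one orbit. If it is a reflection, the orientation changes sign, hence vanishes at `y`,
and `y` lies on a mirror; the reflection can then be traded for a rotation. -/
theorem proj_eq_of_pillowMap_eq {x y : Plane} (h : pillowMap x = pillowMap y) :
    proj pillowGroup x = proj pillowGroup y := by
  obtain ⟨hM, hm, hw⟩ := pillowMap_eq_iff.1 h
  have hcases : (cosTwoPi (x 0) = cosTwoPi (y 0) ∧ cosTwoPi (x 1) = cosTwoPi (y 1)) ∨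
      (cosTwoPi (x 0) = cosTwoPi (y 1) ∧ cosTwoPi (x 1) = cosTwoPi (y 0)) := by
    unfold maxCos minCos at *
    grind
  have sq : ∀ ε : ℝ, ε = 1 ∨ ε = -1 → ε * ε = 1 := by rintro ε (rfl | rfl) <;> norm_num
  rcases hcases with ⟨hc0, hc1⟩ | ⟨hc0, hc1⟩
  · obtain ⟨ε, hε, m, h0⟩ := exists_sign_of_cosTwoPi_eq hc0
    obtain ⟨δ, hδ, n, h1⟩ := exists_sign_of_cosTwoPi_eq hc1
    rcases sign_cases hε hδ with hs | hs
    · exact proj_eq_of_diagonal hε hs h0 h1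
    have hJ : orientationSign x = -orientationSign y := by
      rw [orientationSign, hc0, hc1, h0, h1, sinTwoPi_sign_mul hε, sinTwoPi_sign_mul hδ, hs,
        orientationSign]
      linear_combination (-(sinTwoPi (y 0) * sinTwoPi (y 1) *
        (cosTwoPi (y 0) - cosTwoPi (y 1)))) * sq ε hε
    have hz := orientationSign_eq_zero_of_neg hM hm hw hJ
    rw [orientationSign, mul_eq_zero, mul_eq_zero, sub_eq_zero] at hz
    rcases hz with (hz | hz) | hz
    · obtain ⟨m', h0'⟩ := flip_sign_of_two_mul_int hε h0 (exists_two_mul_eq_int_of_sinTwoPi hz)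
      exact proj_eq_of_diagonal (by rcases hε with rfl | rfl <;> simp) hs h0' h1
    · obtain ⟨n', h1'⟩ := flip_sign_of_two_mul_int hδ h1 (exists_two_mul_eq_int_of_sinTwoPi hz)
      exact proj_eq_of_diagonal hε (by rw [hs, neg_neg]) h0 h1'
    -- On the mirrors where the cosines agree, `y 0 = η * y 1 + k`. Substituting this exchanges the
    -- coordinates and turns the diagonal reflection into an antidiagonal rotation.
    · obtain ⟨η, hη, k, hk⟩ := exists_sign_of_cosTwoPi_eq hz
      subst hs
      rcases hε with rfl | rfl <;> rcases hη with rfl | rfl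
      · exact proj_eq_of_antidiagonal (ε := 1) (m := m + k) (n := n + k) (Or.inl rfl) rfl
          (by push_cast; linarith) (by push_cast; linarith)
      · exact proj_eq_of_antidiagonal (ε := -1) (m := m + k) (n := n - k) (Or.inr rfl) rfl
          (by push_cast; linarith) (by push_cast; linarith)
      · exact proj_eq_of_antidiagonal (ε := -1) (m := m - k) (n := n - k) (Or.inr rfl) rfl
          (by push_cast; linarith) (by push_cast; linarith)
      · exact proj_eq_of_antidiagonal (ε := 1) (m := m - k) (n := n + k) (Or.inl rfl) rfl
          (by push_cast; linarith) (by push_cast; linarith)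
  · obtain ⟨ε, hε, m, h0⟩ := exists_sign_of_cosTwoPi_eq hc0
    obtain ⟨δ, hδ, n, h1⟩ := exists_sign_of_cosTwoPi_eq hc1
    rcases sign_cases hε hδ with hs | hs
    swap
    · exact proj_eq_of_antidiagonal hε hs h0 h1
    have hJ : orientationSign x = -orientationSign y := by
      rw [orientationSign, hc0, hc1, h0, h1, sinTwoPi_sign_mul hε, sinTwoPi_sign_mul hδ, hs,
        orientationSign]
      linear_combination (-(sinTwoPi (y 0) * sinTwoPi (y 1) *
        (cosTwoPi (y 0) - cosTwoPi (y 1)))) * sq ε hε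
    have hz := orientationSign_eq_zero_of_neg hM hm hw hJ
    rw [orientationSign, mul_eq_zero, mul_eq_zero, sub_eq_zero] at hz
    rcases hz with (hz | hz) | hz
    · obtain ⟨n', h1'⟩ := flip_sign_of_two_mul_int hδ h1 (exists_two_mul_eq_int_of_sinTwoPi hz)
      exact proj_eq_of_antidiagonal hε (by rw [hs]) h0 h1'
    · obtain ⟨m', h0'⟩ := flip_sign_of_two_mul_int hε h0 (exists_two_mul_eq_int_of_sinTwoPi hz)
      exact proj_eq_of_antidiagonal (by rcases hε with rfl | rfl <;> simp) (by rw [hs, neg_neg])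
        h0' h1
    · obtain ⟨η, hη, k, hk⟩ := exists_sign_of_cosTwoPi_eq hz
      subst hs
      rcases hδ with rfl | rfl <;> rcases hη with rfl | rfl
      · exact proj_eq_of_diagonal (ε := 1) (m := m - k) (n := n + k) (Or.inl rfl) rfl
          (by push_cast; linarith) (by push_cast; linarith)
      · exact proj_eq_of_diagonal (ε := -1) (m := m + k) (n := n + k) (Or.inr rfl) rfl
          (by push_cast; linarith) (by push_cast; linarith)
      · exact proj_eq_of_diagonal (ε := -1) (m := m + k) (n := n - k) (Or.inr rfl) rfl
          (by push_cast; linarith) (by push_cast; linarith)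
      · exact proj_eq_of_diagonal (ε := 1) (m := m - k) (n := n - k) (Or.inl rfl) rfl
          (by push_cast; linarith) (by push_cast; linarith)

/-! ### The convex body and its frontier -/

/-- The convex body bounded by the image of `pillowMap`. -/
def pillowBody : Set (EuclideanSpace ℝ (Fin 3)) := {p | |p 2| ≤ pillowHeight (p 0) (p 1)}

theorem mem_pillowBody {p : EuclideanSpace ℝ (Fin 3)} :
    p ∈ pillowBody ↔ (|p 2| ≤ 1 - p 0 ∧ |p 2| ≤ 1 + p 1) ∧ |p 2| ≤ p 0 - p 1 := by
  change |p 2| ≤ min (min (1 - p 0) (1 + p 1)) (p 0 - p 1) ↔ _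
  rw [le_min_iff, le_min_iff]

theorem convex_pillowBody : Convex ℝ pillowBody := by
  intro p hp q hq a b ha hb hab
  rw [mem_pillowBody] at hp hq ⊢
  have habs : |(a • p + b • q) 2| ≤ a * |p 2| + b * |q 2| := by
    refine (abs_add_le (a * p 2) (b * q 2)).trans ?_
    rw [abs_mul, abs_mul, abs_of_nonneg ha, abs_of_nonneg hb]
  have h0 : (a • p + b • q) 0 = a * p 0 + b * q 0 := rfl
  have h1 : (a • p + b • q) 1 = a * p 1 + b * q 1 := rfl
  obtain rfl : b = 1 - a := by linarith
  rw [h0, h1]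
  refine ⟨⟨habs.trans ?_, habs.trans ?_⟩, habs.trans ?_⟩
  · linarith [mul_le_mul_of_nonneg_left hp.1.1 ha, mul_le_mul_of_nonneg_left hq.1.1 hb]
  · linarith [mul_le_mul_of_nonneg_left hp.1.2 ha, mul_le_mul_of_nonneg_left hq.1.2 hb]
  · linarith [mul_le_mul_of_nonneg_left hp.2 ha, mul_le_mul_of_nonneg_left hq.2 hb]

theorem continuous_pillowHeight :
    Continuous fun p : EuclideanSpace ℝ (Fin 3) => pillowHeight (p 0) (p 1) := by
  unfold pillowHeight
  fun_prop

theorem continuous_abs_coord : Continuous fun p : EuclideanSpace ℝ (Fin 3) => |p 2| := by fun_prop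

theorem interior_pillowBody_nonempty : (interior pillowBody).Nonempty := by
  refine ⟨!₂[1 / 2, -1 / 2, 0], ?_⟩
  have hopen : IsOpen {p : EuclideanSpace ℝ (Fin 3) | |p 2| < pillowHeight (p 0) (p 1)} :=
    isOpen_lt continuous_abs_coord continuous_pillowHeight
  have hsub : {p : EuclideanSpace ℝ (Fin 3) | |p 2| < pillowHeight (p 0) (p 1)} ⊆ pillowBody :=
    fun p hp => show |p 2| ≤ pillowHeight (p 0) (p 1) from le_of_lt hp
  refine interior_maximal hsub hopen ?_
  change |(0 : ℝ)| < pillowHeight (1 / 2) (-1 / 2)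
  norm_num [pillowHeight]

theorem isBounded_pillowBody : Bornology.IsBounded pillowBody := by
  refine isBounded_iff_forall_norm_le.2 ⟨√(1 ^ 2 + 1 ^ 2 + 2 ^ 2), fun p hp => ?_⟩
  rw [mem_pillowBody] at hp
  have h := abs_nonneg (p 2)
  rw [EuclideanSpace.norm_eq, Fin.sum_univ_three]
  simp only [Real.norm_eq_abs]
  refine Real.sqrt_le_sqrt ?_
  gcongr
  · exact abs_le.2 ⟨by linarith, by linarith⟩
  · exact abs_le.2 ⟨by linarith, by linarith⟩
  · linarith

theorem frontier_pillowBody :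
    frontier pillowBody = {p | |p 2| = pillowHeight (p 0) (p 1)} := by
  refine Set.Subset.antisymm
    (frontier_le_subset_eq continuous_abs_coord continuous_pillowHeight) fun p hp => ?_
  have hp : |p 2| = pillowHeight (p 0) (p 1) := hp
  refine ⟨subset_closure (show p ∈ pillowBody from hp.le), fun hint => ?_⟩
  -- A vertical path through `p` that increases the absolute value of the third coordinate for `t >
  -- 0`. It leaves the body at once, so `p` is not interior.
  have hcont : Continuous fun t : ℝ =>
      (!₂[p 0, p 1, p 2 + (if 0 ≤ p 2 then t else -t)] : EuclideanSpace ℝ (Fin 3)) := by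
    refine (PiLp.continuous_toLp 2 _).comp (continuous_pi fun i => ?_)
    fin_cases i
    · exact continuous_const
    · exact continuous_const
    · split_ifs <;> fun_prop
  have h0 : (!₂[p 0, p 1, p 2 + (if 0 ≤ p 2 then (0 : ℝ) else -0)] : EuclideanSpace ℝ (Fin 3)) =
      p := by
    ext i
    fin_cases i <;> simp
  have hnhds := hcont.continuousAt.preimage_mem_nhds (x := 0)
    (by rw [h0]; exact mem_interior_iff_mem_nhds.1 hint)
  obtain ⟨r, hr, hball⟩ := Metric.mem_nhds_iff.1 hnhds
  have hmem : (r / 2) ∈ Metric.ball (0 : ℝ) r := by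
    rw [mem_ball_zero_iff, Real.norm_eq_abs, abs_of_pos (by linarith)]
    linarith
  have hb : |p 2 + (if 0 ≤ p 2 then r / 2 else -(r / 2))| ≤ pillowHeight (p 0) (p 1) := hball hmem
  rw [← hp] at hb
  split_ifs at hb with hs
  · rw [abs_of_nonneg hs, abs_of_nonneg (by linarith)] at hb
    linarith
  · rw [abs_of_neg (by linarith), abs_of_neg (by linarith)] at hb
    linarith

theorem pillowMap_mem_frontier (x : Plane) : pillowMap x ∈ frontier pillowBody := by
  rw [frontier_pillowBody]
  change |signedHeight x| = pillowHeight (maxCos x) (minCos x)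
  have h := pillowHeight_nonneg (maxCos_le_one x) (neg_one_le_minCos x) (minCos_le_maxCos x)
  unfold signedHeight
  split_ifs
  · exact abs_of_nonneg h
  · rw [abs_neg, abs_of_nonneg h]

/-- The values `s` and `t` given by the arccosine have nonnegative sines, and `cos 2πs ≥ cos 2πt`.
So `(s, t)` lies on the upper sheet, and exchanging the coordinates reaches the lower one. -/
theorem exists_pillowMap_eq {p : EuclideanSpace ℝ (Fin 3)} (hp : p ∈ frontier pillowBody) :
    ∃ x, pillowMap x = p := by
  rw [frontier_pillowBody] at hp
  have hp : |p 2| = pillowHeight (p 0) (p 1) := hp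
  obtain ⟨⟨h0, h1⟩, h2⟩ := mem_pillowBody.1 (show p ∈ pillowBody from hp.le)
  have habs := abs_nonneg (p 2)
  set s := Real.arccos (p 0) / (2 * Real.pi)
  set t := Real.arccos (p 1) / (2 * Real.pi)
  have cs : cosTwoPi s = p 0 := cosTwoPi_arccos (by linarith) (by linarith)
  have ct : cosTwoPi t = p 1 := cosTwoPi_arccos (by linarith) (by linarith)
  have ss : 0 ≤ sinTwoPi s := sinTwoPi_arccos_nonneg _
  have st : 0 ≤ sinTwoPi t := sinTwoPi_arccos_nonneg _
  have hst : 0 ≤ sinTwoPi s * sinTwoPi t * (p 0 - p 1) :=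
    mul_nonneg (mul_nonneg ss st) (by linarith)
  have hle : p 1 ≤ p 0 := by linarith
  have hp3 : ∀ w : ℝ, w = p 2 → (!₂[p 0, p 1, w] : EuclideanSpace ℝ (Fin 3)) = p := by
    rintro w rfl
    ext i
    fin_cases i <;> rfl
  rcases le_or_gt 0 (p 2) with hw | hw
  · refine ⟨!₂[s, t], ?_⟩
    have hM : maxCos !₂[s, t] = p 0 := by
      change max (cosTwoPi s) (cosTwoPi t) = _
      rw [cs, ct, max_eq_left hle]
    have hm : minCos !₂[s, t] = p 1 := by
      change min (cosTwoPi s) (cosTwoPi t) = _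
      rw [cs, ct, min_eq_right hle]
    have hJ : 0 ≤ orientationSign !₂[s, t] := by
      change 0 ≤ sinTwoPi s * sinTwoPi t * (cosTwoPi s - cosTwoPi t)
      rwa [cs, ct]
    rw [pillowMap, signedHeight, if_pos hJ, hM, hm]
    exact hp3 _ (by rw [← hp, abs_of_nonneg hw])
  · refine ⟨!₂[t, s], ?_⟩
    have hM : maxCos !₂[t, s] = p 0 := by
      change max (cosTwoPi t) (cosTwoPi s) = _
      rw [cs, ct, max_eq_right hle]
    have hm : minCos !₂[t, s] = p 1 := by
      change min (cosTwoPi t) (cosTwoPi s) = _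
      rw [cs, ct, min_eq_left hle]
    -- Orientation zero selects the nonnegative branch, so the lower sheet needs a strict sign; it
    -- comes from `p 2 < 0`, which makes the height nonzero.
    have hne : orientationSign !₂[t, s] ≠ 0 := by
      rw [Ne, orientationSign_eq_zero_iff, hM, hm, ← hp]
      exact abs_ne_zero.2 hw.ne
    have hJ : orientationSign !₂[t, s] ≤ 0 := by
      change sinTwoPi t * sinTwoPi s * (cosTwoPi t - cosTwoPi s) ≤ 0
      rw [cs, ct]
      linarith
    rw [pillowMap, signedHeight, if_neg (not_le.2 (lt_of_le_of_ne hJ hne)), hM, hm]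
    exact hp3 _ (by rw [← hp, abs_of_neg hw, neg_neg])

/-- The homeomorphism of the first quotient with the boundary of a convex body. -/
theorem nonempty_homeomorph_frontier :
    Nonempty (Underlying pillowGroup ≃ₜ frontier pillowBody) := by
  have := compactSpace_underlying_pillowGroup
  let f : Underlying pillowGroup → frontier pillowBody :=
    Quotient.lift (fun x => ⟨pillowMap x, pillowMap_mem_frontier x⟩) fun x y h =>
      Subtype.ext (pillowMap_eq_of_proj_eq (Quotient.sound h))
  have hf : Continuous f := (continuous_pillowMap.subtype_mk _).quotient_lift _
  have hbij : Function.Bijective f := by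
    constructor
    · intro a b h
      obtain ⟨x, rfl⟩ := Quotient.exists_rep a
      obtain ⟨y, rfl⟩ := Quotient.exists_rep b
      exact proj_eq_of_pillowMap_eq (congrArg Subtype.val h)
    · rintro ⟨p, hp⟩
      obtain ⟨x, hx⟩ := exists_pillowMap_eq hp
      exact ⟨proj pillowGroup x, Subtype.ext hx⟩
  exact ⟨(isHomeomorph_iff_continuous_bijective.2 ⟨hf, hbij⟩).homeomorph⟩

theorem nonempty_homeomorph_sphere :
    Nonempty (Underlying pillowGroup ≃ₜ Metric.sphere (0 : EuclideanSpace ℝ (Fin 3)) 1) := by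
  obtain ⟨e⟩ := nonempty_homeomorph_frontier
  obtain ⟨h, -, -, hfr⟩ := exists_homeomorph_image_interior_closure_frontier_eq_unitBall
    convex_pillowBody interior_pillowBody_nonempty isBounded_pillowBody
  exact ⟨e.trans ((h.image _).trans (Homeomorph.setCongr hfr))⟩

/-! ### One-forms in coordinates -/

/-- The `i`-th coordinate function as a continuous linear form. -/
def coordCLM (i : Fin 2) : Plane →L[ℝ] ℝ := EuclideanSpace.proj i

theorem coordCLM_apply (i : Fin 2) (x : Plane) : coordCLM i x = x i := rfl

/-- The one-form `dxᵢ`. -/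
def dualFrame (i : Fin 2) : Plane [⋀^Fin 1]→L[ℝ] ℝ :=
  ContinuousAlternatingMap.ofSubsingleton ℝ Plane ℝ 0 (coordCLM i)

theorem dualFrame_apply (i : Fin 2) (v : Fin 1 → Plane) : dualFrame i v = v 0 i := rfl

/-- The form `f dx + g dy`. -/
def oneForm (f g : Plane → ℝ) : Form 1 := fun x => f x • dualFrame 0 + g x • dualFrame 1

theorem oneForm_apply (f g : Plane → ℝ) (x : Plane) (v : Fin 1 → Plane) :
    oneForm f g x v = f x * v 0 0 + g x * v 0 1 := rfl

/-- The area form `dx ∧ dy`. -/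
def areaForm : Plane [⋀^Fin 2]→L[ℝ] ℝ :=
  ContinuousAlternatingMap.alternatizeUncurryFin ((coordCLM 0).smulRight (dualFrame 1))

theorem areaForm_apply (v : Fin 2 → Plane) : areaForm v = v 0 0 * v 1 1 - v 1 0 * v 0 1 := by
  rw [areaForm, ContinuousAlternatingMap.alternatizeUncurryFin_apply, Fin.sum_univ_two]
  simp [dualFrame_apply, coordCLM_apply, Fin.removeNth, Fin.tail]
  ring

theorem alternating_one_ext {a b : Plane [⋀^Fin 1]→L[ℝ] ℝ}
    (h : ∀ i, a (fun _ => frame i) = b (fun _ => frame i)) : a = b := by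
  have hexp : ∀ c : Plane [⋀^Fin 1]→L[ℝ] ℝ, ∀ v : Plane,
      c (fun _ => v) = v 0 * c (fun _ => frame 0) + v 1 * c (fun _ => frame 1) := by
    intro c v
    obtain ⟨l, rfl⟩ := (ContinuousAlternatingMap.ofSubsingleton ℝ Plane ℝ (0 : Fin 1)).surjective c
    change l v = v 0 * l (frame 0) + v 1 * l (frame 1)
    have hv : v = v 0 • frame 0 + v 1 • frame 1 := by
      apply plane_ext <;> simp [frame]
    conv_lhs => rw [hv]
    simp
  ext v
  have hv : v = fun _ => v 0 := by
    funext i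
    rw [Subsingleton.elim i 0]
  rw [hv, hexp a, hexp b, h 0, h 1]

theorem pullback_oneForm_eq_iff {g : Motion} {ω : Form 1} :
    pullback g ω = ω ↔
      ∀ x i, ω (g x) (fun _ => linearPart g (frame i)) = ω x (fun _ => frame i) := by
  constructor
  · intro h x i
    conv_rhs => rw [← h]
    rfl
  · intro h
    funext x
    exact alternating_one_ext fun i => h x i

/-- The function `f` has the partial derivatives `fx` and `fy`. -/
def HasPartials (f fx fy : Plane → ℝ) : Prop :=
  ∀ x, HasFDerivAt f (fx x • coordCLM 0 + fy x • coordCLM 1) x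

theorem HasPartials.const_mul {f fx fy : Plane → ℝ} (h : HasPartials f fx fy) (c : ℝ) :
    HasPartials (fun x => c * f x) (fun x => c * fx x) (fun x => c * fy x) := by
  intro x
  convert! (h x).const_mul c using 1
  ext v
  simp
  ring

theorem HasPartials.sub {f fx fy g gx gy : Plane → ℝ} (hf : HasPartials f fx fy)
    (hg : HasPartials g gx gy) :
    HasPartials (fun x => f x - g x) (fun x => fx x - gx x) (fun x => fy x - gy x) := by
  intro x
  convert! (hf x).sub (hg x) using 1
  ext v
  simp
  ring

theorem HasPartials.neg_add {f fx fy g gx gy : Plane → ℝ} (hf : HasPartials f fx fy)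
    (hg : HasPartials g gx gy) :
    HasPartials (fun x => -(f x + g x)) (fun x => -(fx x + gx x)) (fun x => -(fy x + gy x)) := by
  intro x
  convert! ((hf x).add (hg x)).neg using 1
  ext v
  simp
  ring

theorem hasFDerivAt_oneForm {f fx fy g gx gy : Plane → ℝ} (hf : HasPartials f fx fy)
    (hg : HasPartials g gx gy) (x : Plane) :
    HasFDerivAt (oneForm f g)
      ((fx x • coordCLM 0 + fy x • coordCLM 1).smulRight (dualFrame 0) +
        (gx x • coordCLM 0 + gy x • coordCLM 1).smulRight (dualFrame 1)) x :=
  ((hf x).smul_const (dualFrame 0)).add ((hg x).smul_const (dualFrame 1))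

theorem extDeriv_oneForm {f fx fy g gx gy : Plane → ℝ} (hf : HasPartials f fx fy)
    (hg : HasPartials g gx gy) :
    extDeriv (oneForm f g) = fun x => (gx x - fy x) • areaForm := by
  funext x
  rw [extDeriv, (hasFDerivAt_oneForm hf hg x).fderiv]
  ext v
  rw [ContinuousAlternatingMap.alternatizeUncurryFin_apply, Fin.sum_univ_two]
  simp [dualFrame_apply, coordCLM_apply, Fin.removeNth, Fin.tail, areaForm_apply]
  ring

theorem codiff_oneForm {f fx fy g gx gy : Plane → ℝ} (hf : HasPartials f fx fy)
    (hg : HasPartials g gx gy) :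
    codiff (oneForm f g) = fun x =>
      ContinuousAlternatingMap.constOfIsEmpty ℝ Plane (Fin 0) (-(fx x + gy x)) := by
  funext x
  rw [codiff, (hasFDerivAt_oneForm hf hg x).fderiv]
  ext v
  simp [dualFrame_apply, coordCLM_apply, frame]

/-- In the flat metric the Hodge Laplacian acts on each component. The hypotheses use one function
`fxy` (and one `gxy`) for both mixed derivatives, which is what cancels the cross terms of `dδ` and
`δd`. -/
theorem hodgeLaplacian_oneForm {f fx fy fxx fxy fyy g gx gy gxx gxy gyy : Plane → ℝ}
    (hf : HasPartials f fx fy) (hg : HasPartials g gx gy)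
    (hfx : HasPartials fx fxx fxy) (hfy : HasPartials fy fxy fyy)
    (hgx : HasPartials gx gxx gxy) (hgy : HasPartials gy gxy gyy) (x : Plane) :
    hodgeLaplacian (oneForm f g) x =
      oneForm (fun x => -(fxx x + fyy x)) (fun x => -(gxx x + gyy x)) x := by
  change extDeriv (codiff (oneForm f g)) x + codiff (extDeriv (oneForm f g)) x = _
  rw [codiff_oneForm hf hg, extDeriv_constOfIsEmpty, ((hfx.neg_add hgy) x).fderiv,
    extDeriv_oneForm hf hg, codiff, (((hgx.sub hfy) x).smul_const areaForm).fderiv]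
  refine alternating_one_ext fun i => ?_
  fin_cases i
  · simp [oneForm_apply, coordCLM_apply, frame, areaForm_apply, Fin.sum_univ_two]
    ring
  · simp [oneForm_apply, coordCLM_apply, frame, areaForm_apply, Fin.sum_univ_two]
    ring

theorem formInner_one (a b : Plane [⋀^Fin 1]→L[ℝ] ℝ) :
    formInner a b = a (fun _ => frame 0) * b (fun _ => frame 0) +
      a (fun _ => frame 1) * b (fun _ => frame 1) := by
  rw [formInner]
  simp only [Nat.factorial_one, Nat.cast_one, inv_one, one_mul]
  rw [← (Equiv.funUnique (Fin 1) (Fin 2)).symm.sum_comp, Fin.sum_univ_two]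
  rfl

theorem formInner_oneForm (a : Plane [⋀^Fin 1]→L[ℝ] ℝ) (f g : Plane → ℝ) (x : Plane) :
    formInner a (oneForm f g x) = a (fun _ => frame 0) * f x + a (fun _ => frame 1) * g x := by
  rw [formInner_one]
  simp [oneForm_apply, frame]

theorem formInner_oneForm_oneForm (f g f' g' : Plane → ℝ) (x : Plane) :
    formInner (oneForm f g x) (oneForm f' g' x) = f x * f' x + g x * g' x := by
  rw [formInner_oneForm]
  simp [oneForm_apply, frame]

theorem contDiff_oneForm {f g : Plane → ℝ} {n : WithTop ℕ∞} (hf : ContDiff ℝ n f)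
    (hg : ContDiff ℝ n g) : ContDiff ℝ n (oneForm f g) :=
  (hf.smul contDiff_const).add (hg.smul contDiff_const)

/-! ### Separated modes -/

/-- The product of a function of the first and a function of the second coordinate. -/
def tensor (p q : ℝ → ℝ) (x : Plane) : ℝ := p (x 0) * q (x 1)

theorem contDiff_tensor {p q : ℝ → ℝ} {n : WithTop ℕ∞} (hp : ContDiff ℝ n p)
    (hq : ContDiff ℝ n q) : ContDiff ℝ n (tensor p q) :=
  (hp.comp (coordCLM 0).contDiff).mul (hq.comp (coordCLM 1).contDiff)

theorem hasPartials_tensor {p p' q q' : ℝ → ℝ} (hp : ∀ t, HasDerivAt p (p' t) t)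
    (hq : ∀ t, HasDerivAt q (q' t) t) :
    HasPartials (tensor p q) (tensor p' q) (tensor p q') := by
  intro x
  have h := ((hp (x 0)).comp_hasFDerivAt x (coordCLM 0).hasFDerivAt).mul
    ((hq (x 1)).comp_hasFDerivAt x (coordCLM 1).hasFDerivAt)
  convert! h using 1
  ext v
  simp [tensor, coordCLM_apply]
  ring

/-- The function `sin (2 π m ·)`. -/
def sinMode (m : ℤ) (t : ℝ) : ℝ := Real.sin (2 * Real.pi * m * t)

/-- The function `cos (2 π m ·)`. -/
def cosMode (m : ℤ) (t : ℝ) : ℝ := Real.cos (2 * Real.pi * m * t)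

theorem contDiff_sinMode (m : ℤ) {n : WithTop ℕ∞} : ContDiff ℝ n (sinMode m) :=
  Real.contDiff_sin.comp (contDiff_const.mul contDiff_id)

theorem contDiff_cosMode (m : ℤ) {n : WithTop ℕ∞} : ContDiff ℝ n (cosMode m) :=
  Real.contDiff_cos.comp (contDiff_const.mul contDiff_id)

theorem hasDerivAt_sinMode (m : ℤ) (t : ℝ) :
    HasDerivAt (sinMode m) (2 * Real.pi * m * cosMode m t) t := by
  have h := ((hasDerivAt_id t).const_mul (2 * Real.pi * m)).sin
  convert! h using 1
  simp [cosMode]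
  ring

theorem hasDerivAt_cosMode (m : ℤ) (t : ℝ) :
    HasDerivAt (cosMode m) (-(2 * Real.pi * m) * sinMode m t) t := by
  have h := ((hasDerivAt_id t).const_mul (2 * Real.pi * m)).cos
  convert! h using 1
  simp [sinMode]
  ring

theorem hasDerivAt_const_mul_cosMode (m : ℤ) (t : ℝ) :
    HasDerivAt (fun t => 2 * Real.pi * m * cosMode m t)
      (-(2 * Real.pi * m) ^ 2 * sinMode m t) t := by
  refine ((hasDerivAt_cosMode m t).const_mul (2 * Real.pi * m)).congr_deriv ?_
  ring

theorem hasDerivAt_const_mul_sinMode (m : ℤ) (t : ℝ) :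
    HasDerivAt (fun t => -(2 * Real.pi * m) * sinMode m t)
      (-(2 * Real.pi * m) ^ 2 * cosMode m t) t := by
  refine ((hasDerivAt_sinMode m t).const_mul (-(2 * Real.pi * m))).congr_deriv ?_
  ring

/-- The scalar mode `sin (2 π m x) cos (2 π n y)`. -/
def sinCos (m n : ℤ) : Plane → ℝ := tensor (sinMode m) (cosMode n)

/-- The scalar mode `cos (2 π n x) sin (2 π m y)`. -/
def cosSin (m n : ℤ) : Plane → ℝ := tensor (cosMode n) (sinMode m)

/-- The eigenvalue of the modes with frequencies `m` and `n`. -/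
def modeEigenvalue (m n : ℤ) : ℝ := (2 * Real.pi * m) ^ 2 + (2 * Real.pi * n) ^ 2

theorem contDiff_sinCos (m n : ℤ) {k : WithTop ℕ∞} : ContDiff ℝ k (sinCos m n) :=
  contDiff_tensor (contDiff_sinMode m) (contDiff_cosMode n)

theorem contDiff_cosSin (m n : ℤ) {k : WithTop ℕ∞} : ContDiff ℝ k (cosSin m n) :=
  contDiff_tensor (contDiff_cosMode n) (contDiff_sinMode m)

/-- `f` is a smooth eigenfunction with eigenvalue `μ`, with the given first derivatives. -/
structure IsScalarMode (f fx fy : Plane → ℝ) (μ : ℝ) : Prop where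
  partials : HasPartials f fx fy
  second : ∃ fxx fxy fyy : Plane → ℝ, HasPartials fx fxx fxy ∧ HasPartials fy fxy fyy ∧
    ∀ x, -(fxx x + fyy x) = μ * f x

theorem IsScalarMode.const_mul {f fx fy : Plane → ℝ} {μ : ℝ} (h : IsScalarMode f fx fy μ) (c : ℝ) :
    IsScalarMode (fun x => c * f x) (fun x => c * fx x) (fun x => c * fy x) μ := by
  obtain ⟨fxx, fxy, fyy, h1, h2, h3⟩ := h.second
  refine ⟨h.partials.const_mul c, _, _, _, h1.const_mul c, h2.const_mul c, fun x => ?_⟩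
  linear_combination c * h3 x

theorem IsScalarMode.hodgeLaplacian_oneForm {f fx fy g gx gy : Plane → ℝ} {μ : ℝ}
    (hf : IsScalarMode f fx fy μ) (hg : IsScalarMode g gx gy μ) (x : Plane) :
    hodgeLaplacian (oneForm f g) x = μ • oneForm f g x := by
  obtain ⟨fxx, fxy, fyy, f1, f2, f3⟩ := hf.second
  obtain ⟨gxx, gxy, gyy, g1, g2, g3⟩ := hg.second
  rw [FlatOrbifold.hodgeLaplacian_oneForm hf.partials hg.partials f1 f2 g1 g2]
  simp only [oneForm]
  rw [f3, g3, smul_add, smul_smul, smul_smul]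

theorem isScalarMode_sinCos (m n : ℤ) :
    IsScalarMode (sinCos m n) (tensor (fun t => 2 * Real.pi * m * cosMode m t) (cosMode n))
      (tensor (sinMode m) (fun t => -(2 * Real.pi * n) * sinMode n t)) (modeEigenvalue m n) := by
  refine ⟨hasPartials_tensor (hasDerivAt_sinMode m) (hasDerivAt_cosMode n), _, _, _,
    hasPartials_tensor (hasDerivAt_const_mul_cosMode m) (hasDerivAt_cosMode n),
    hasPartials_tensor (hasDerivAt_sinMode m) (hasDerivAt_const_mul_sinMode n), fun x => ?_⟩
  simp only [tensor, sinCos, modeEigenvalue]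
  ring

theorem isScalarMode_cosSin (m n : ℤ) :
    IsScalarMode (cosSin m n) (tensor (fun t => -(2 * Real.pi * n) * sinMode n t) (sinMode m))
      (tensor (cosMode n) (fun t => 2 * Real.pi * m * cosMode m t)) (modeEigenvalue m n) := by
  refine ⟨hasPartials_tensor (hasDerivAt_cosMode n) (hasDerivAt_sinMode m), _, _, _,
    hasPartials_tensor (hasDerivAt_const_mul_sinMode n) (hasDerivAt_sinMode m),
    hasPartials_tensor (hasDerivAt_cosMode n) (hasDerivAt_const_mul_cosMode m), fun x => ?_⟩
  simp only [tensor, cosSin, modeEigenvalue]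
  ring

/-! ### Symmetries and boundary values of the modes -/

theorem sinMode_add_int (m : ℤ) (t : ℝ) (k : ℤ) : sinMode m (t + k) = sinMode m t := by
  rw [sinMode, sinMode, ← Real.sin_add_int_mul_two_pi (2 * Real.pi * m * t) (m * k)]
  push_cast
  ring_nf

theorem cosMode_add_int (m : ℤ) (t : ℝ) (k : ℤ) : cosMode m (t + k) = cosMode m t := by
  rw [cosMode, cosMode, ← Real.cos_add_int_mul_two_pi (2 * Real.pi * m * t) (m * k)]
  push_cast
  ring_nf

theorem sinMode_neg_arg (m : ℤ) (t : ℝ) : sinMode m (-t) = -sinMode m t := by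
  rw [sinMode, mul_neg, Real.sin_neg, sinMode]

theorem cosMode_neg_arg (m : ℤ) (t : ℝ) : cosMode m (-t) = cosMode m t := by
  rw [cosMode, mul_neg, Real.cos_neg, cosMode]

theorem sinMode_neg (m : ℤ) (t : ℝ) : sinMode (-m) t = -sinMode m t := by
  rw [sinMode, sinMode, ← Real.sin_neg]
  push_cast
  ring_nf

theorem cosMode_neg (m : ℤ) (t : ℝ) : cosMode (-m) t = cosMode m t := by
  rw [cosMode, cosMode, ← Real.cos_neg]
  push_cast
  ring_nf

theorem sinMode_zero (t : ℝ) : sinMode 0 t = 0 := by simp [sinMode]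

theorem cosMode_zero (t : ℝ) : cosMode 0 t = 1 := by simp [cosMode]

theorem sinMode_onEdge (m : ℤ) {i : Fin 2} {x : Plane} (h : OnEdge i x) : sinMode m (x i) = 0 := by
  rcases h.2 with h | h <;> rw [h, sinMode]
  · simp
  · rw [show 2 * Real.pi * m * (1 / 2) = m * Real.pi by ring]
    exact Real.sin_int_mul_pi m

/-- The motions of `ℤ² ⋊ V₄` act on coordinates by signs and integer translations. -/
theorem pullback_squareGroup {f g : Plane → ℝ} (h : ∀ ε δ : ℝ, (ε = 1 ∨ ε = -1) →
      (δ = 1 ∨ δ = -1) → ∀ (m n : ℤ) (x y : Plane), y 0 = ε * x 0 + m → y 1 = δ * x 1 + n →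
        f y = ε * f x ∧ g y = δ * g x) {σ : Motion} (hσ : σ ∈ squareGroup) :
    pullback σ (oneForm f g) = oneForm f g := by
  have hσ' : ∃ ε δ : ℝ, (ε = 1 ∨ ε = -1) ∧ (δ = 1 ∨ δ = -1) ∧
      ∀ x, linearPart σ x = !₂[ε * x 0, δ * x 1] := by
    rcases mem_kleinGroup.1 hσ.1 with e | e | e | e <;> rw [e]
    · exact ⟨1, 1, by simp, by simp, fun x => by apply plane_ext <;> simp⟩
    · exact ⟨1, -1, by simp, by simp, fun x => by
        rw [axisReflection_zero_apply]; apply plane_ext <;> simp⟩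
    · exact ⟨-1, 1, by simp, by simp, fun x => by
        rw [axisReflection_one_apply]; apply plane_ext <;> simp⟩
    · exact ⟨-1, -1, by simp, by simp, fun x => by
        rw [axisReflection_mul]; apply plane_ext <;> simp⟩
  obtain ⟨ε, δ, hε, hδ, hl⟩ := hσ'
  obtain ⟨⟨m, hm⟩, n, hn⟩ := mem_intLattice.1 hσ.2
  rw [pullback_oneForm_eq_iff]
  intro x i
  have h0 : σ x 0 = ε * x 0 + m := by rw [motion_apply σ, hl, ← hm]; rfl
  have h1 : σ x 1 = δ * x 1 + n := by rw [motion_apply σ, hl, ← hn]; rfl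
  obtain ⟨hf, hg⟩ := h ε δ hε hδ m n x (σ x) h0 h1
  rw [hl, oneForm_apply, oneForm_apply, hf, hg]
  have sq : ∀ ε : ℝ, ε = 1 ∨ ε = -1 → ε * ε = 1 := by rintro ε (rfl | rfl) <;> norm_num
  have e2 := sq ε hε
  have d2 := sq δ hδ
  fin_cases i
  · simp [frame]
    linear_combination f x * e2
  · simp [frame]
    linear_combination g x * d2

theorem sinMode_sign {ε : ℝ} (hε : ε = 1 ∨ ε = -1) (m k : ℤ) (t : ℝ) :
    sinMode m (ε * t + k) = ε * sinMode m t := by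
  rw [sinMode_add_int]
  rcases hε with rfl | rfl
  · simp
  · simp [sinMode_neg_arg]

theorem cosMode_sign {ε : ℝ} (hε : ε = 1 ∨ ε = -1) (m k : ℤ) (t : ℝ) :
    cosMode m (ε * t + k) = cosMode m t := by
  rw [cosMode_add_int]
  rcases hε with rfl | rfl
  · simp
  · simp [cosMode_neg_arg]

/-- The form `a sin (2πmx) cos (2πny) dx + b cos (2πnx) sin (2πmy) dy`. -/
def evenModeForm (a b : ℝ) (m n : ℤ) : Form 1 :=
  oneForm (fun x => a * sinCos m n x) (fun x => b * cosSin m n x)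

/-- The form `a (cos (2πnx) sin (2πmy) dx - sin (2πmx) cos (2πny) dy)`. -/
def oddModeForm (a : ℝ) (m n : ℤ) : Form 1 :=
  oneForm (fun x => a * cosSin m n x) (fun x => -a * sinCos m n x)

theorem contDiff_evenModeForm (a b : ℝ) (m n : ℤ) {k : WithTop ℕ∞} :
    ContDiff ℝ k (evenModeForm a b m n) :=
  contDiff_oneForm (contDiff_const.mul (contDiff_sinCos m n))
    (contDiff_const.mul (contDiff_cosSin m n))

theorem contDiff_oddModeForm (a : ℝ) (m n : ℤ) {k : WithTop ℕ∞} :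
    ContDiff ℝ k (oddModeForm a m n) :=
  contDiff_oneForm (contDiff_const.mul (contDiff_cosSin m n))
    (contDiff_const.mul (contDiff_sinCos m n))

theorem hodgeLaplacian_evenModeForm (a b : ℝ) (m n : ℤ) (x : Plane) :
    hodgeLaplacian (evenModeForm a b m n) x = modeEigenvalue m n • evenModeForm a b m n x :=
  ((isScalarMode_sinCos m n).const_mul a).hodgeLaplacian_oneForm
    ((isScalarMode_cosSin m n).const_mul b) x

theorem hodgeLaplacian_oddModeForm (a : ℝ) (m n : ℤ) (x : Plane) :
    hodgeLaplacian (oddModeForm a m n) x = modeEigenvalue m n • oddModeForm a m n x :=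
  ((isScalarMode_cosSin m n).const_mul a).hodgeLaplacian_oneForm
    ((isScalarMode_sinCos m n).const_mul (-a)) x

/-- Each component is odd in its own coordinate and even in the other, so its sign change under a
reflection cancels that of `dx` or `dy`. The two coefficients are independent here. -/
theorem evenModeForm_mem_orbifoldEigenforms_squareGroup (a b : ℝ) (m n : ℤ) :
    evenModeForm a b m n ∈ orbifoldEigenforms 1 squareGroup (modeEigenvalue m n) := by
  refine ⟨contDiff_evenModeForm a b m n, fun σ hσ => pullback_squareGroup ?_ hσ,
    hodgeLaplacian_evenModeForm a b m n⟩
  intro ε δ hε hδ k l x y h0 h1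
  simp only [sinCos, cosSin, tensor, h0, h1, sinMode_sign hε, sinMode_sign hδ, cosMode_sign hε,
    cosMode_sign hδ]
  constructor <;> ring

/-- Forms that are invariant under the quarter turn and lattice translations are invariant under
`ℤ² ⋊ C₄`. -/
theorem pullback_pillowGroup {f g : Plane → ℝ}
    (ht : ∀ (m n : ℤ) (x y : Plane), y 0 = x 0 + m → y 1 = x 1 + n → f y = f x ∧ g y = g x)
    (hr : ∀ x, f x = g (quarterTurn x) ∧ g x = -f (quarterTurn x)) {σ : Motion}
    (hσ : σ ∈ pillowGroup) : pullback σ (oneForm f g) = oneForm f g := by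
  obtain ⟨⟨m, hm⟩, n, hn⟩ := mem_intLattice.1 hσ.2
  have hr1 : ∀ x, f (quarterTurn x) = -g x ∧ g (quarterTurn x) = f x := fun x =>
    ⟨by rw [(hr x).2, neg_neg], (hr x).1.symm⟩
  have hr2 : ∀ x, f ((quarterTurn ^ 2) x) = -f x ∧ g ((quarterTurn ^ 2) x) = -g x := by
    intro x
    rw [pow_two, orth_mul_apply]
    exact ⟨by rw [(hr1 _).1, (hr1 _).2], by rw [(hr1 _).2, (hr1 _).1]⟩
  have hr3 : ∀ x, f ((quarterTurn ^ 3) x) = g x ∧ g ((quarterTurn ^ 3) x) = -f x := by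
    intro x
    rw [pow_succ', orth_mul_apply]
    exact ⟨by rw [(hr1 _).1, (hr2 _).2, neg_neg], by rw [(hr1 _).2, (hr2 _).1]⟩
  rw [pullback_oneForm_eq_iff]
  intro x i
  have h0 : σ x 0 = linearPart σ x 0 + m := by rw [motion_apply σ, ← hm]; rfl
  have h1 : σ x 1 = linearPart σ x 1 + n := by rw [motion_apply σ, ← hn]; rfl
  rw [oneForm_apply, oneForm_apply, (ht m n _ _ h0 h1).1, (ht m n _ _ h0 h1).2]
  rcases mem_rotGroup.1 hσ.1 with e | e | e | e <;> rw [e]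
  · simp
  · rw [(hr1 x).1, (hr1 x).2, quarterTurn_apply]
    fin_cases i <;> simp [frame]
  · rw [(hr2 x).1, (hr2 x).2, quarterTurn_sq_apply]
    fin_cases i <;> simp [frame]
  · rw [(hr3 x).1, (hr3 x).2, quarterTurn_cube_apply]
    fin_cases i <;> simp [frame]

/-- The quarter turn exchanges the two components, which requires equal coefficients. -/
theorem evenModeForm_mem_orbifoldEigenforms_pillowGroup (a : ℝ) (m n : ℤ) :
    evenModeForm a a m n ∈ orbifoldEigenforms 1 pillowGroup (modeEigenvalue m n) := by
  refine ⟨contDiff_evenModeForm a a m n, fun σ hσ => pullback_pillowGroup ?_ ?_ hσ,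
    hodgeLaplacian_evenModeForm a a m n⟩
  · intro k l x y h0 h1
    simp only [sinCos, cosSin, tensor, h0, h1, sinMode_add_int, cosMode_add_int, and_self]
  · intro x
    rw [quarterTurn_apply]
    simp [sinCos, cosSin, tensor, sinMode_neg_arg, cosMode_neg_arg, mul_comm]

theorem oddModeForm_mem_orbifoldEigenforms_pillowGroup (a : ℝ) (m n : ℤ) :
    oddModeForm a m n ∈ orbifoldEigenforms 1 pillowGroup (modeEigenvalue m n) := by
  refine ⟨contDiff_oddModeForm a m n, fun σ hσ => pullback_pillowGroup ?_ ?_ hσ,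
    hodgeLaplacian_oddModeForm a m n⟩
  · intro k l x y h0 h1
    simp only [sinCos, cosSin, tensor, h0, h1, sinMode_add_int, cosMode_add_int, and_self]
  · intro x
    rw [quarterTurn_apply]
    simp [sinCos, cosSin, tensor, sinMode_neg_arg, cosMode_neg_arg, mul_comm]

theorem normalPart_eq_zero {p : ℕ} {ν : Plane} {a : Plane [⋀^Fin (p + 1)]→L[ℝ] ℝ}
    (h : a.curryLeft ν = 0) : normalPart ν a = 0 := by
  rw [normalPart, h]
  rfl

/-- On an edge orthogonal to `frame i`, component `i` carries a factor `sin 2πm xᵢ`, which vanishes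
there. The coefficient of `dω` is a combination of products with one sine in each coordinate, so it
vanishes on all edges. -/
theorem evenModeForm_mem_squareEigenforms (a b : ℝ) (m n : ℤ) :
    evenModeForm a b m n ∈ squareEigenforms 1 (modeEigenvalue m n) := by
  refine ⟨contDiff_evenModeForm a b m n, fun i x hx => ⟨?_, ?_⟩,
    fun x _ => hodgeLaplacian_evenModeForm a b m n x⟩
  · refine normalPart_eq_zero ?_
    ext v
    rw [ContinuousAlternatingMap.curryLeft_apply_apply, evenModeForm, oneForm_apply]
    have hs := sinMode_onEdge m hx
    fin_cases i
    · have hs : sinMode m (x 0) = 0 := hs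
      simp [sinCos, tensor, hs, frame]
    · have hs : sinMode m (x 1) = 0 := hs
      simp [cosSin, tensor, hs, frame]
  · refine normalPart_eq_zero ?_
    have hs := sinMode_onEdge m hx
    have hs' := sinMode_onEdge n hx
    rw [evenModeForm, extDeriv_oneForm ((isScalarMode_sinCos m n).const_mul a).partials
      ((isScalarMode_cosSin m n).const_mul b).partials]
    have hz : b * tensor (fun t => -(2 * Real.pi * n) * sinMode n t) (sinMode m) x -
        a * tensor (sinMode m) (fun t => -(2 * Real.pi * n) * sinMode n t) x = 0 := by
      fin_cases i
      · have hs : sinMode m (x 0) = 0 := hs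
        have hs' : sinMode n (x 0) = 0 := hs'
        simp [tensor, hs, hs']
      · have hs : sinMode m (x 1) = 0 := hs
        have hs' : sinMode n (x 1) = 0 := hs'
        simp [tensor, hs, hs']
    beta_reduce
    rw [hz, zero_smul, ContinuousAlternatingMap.curryLeft_zero]
    rfl

/-! ### Integrals over the square -/

theorem measurableSet_square : MeasurableSet square := isCompact_square.isClosed.measurableSet

instance isFiniteMeasure_restrict_square :
    IsFiniteMeasure ((volume : Measure Plane).restrict square) :=
  ⟨by rw [Measure.restrict_apply_univ]; exact isCompact_square.measure_lt_top⟩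

theorem setIntegral_square_tensor (p q : ℝ → ℝ) :
    ∫ x in square, tensor p q x =
      (∫ t in Set.Icc (0 : ℝ) (1 / 2), p t) * ∫ t in Set.Icc (0 : ℝ) (1 / 2), q t := by
  have hmp : MeasurePreserving
      ((MeasurableEquiv.toLp 2 (Fin 2 → ℝ)).symm.trans MeasurableEquiv.finTwoArrow)
      (volume : Measure Plane) volume :=
    (EuclideanSpace.volume_preserving_symm_measurableEquiv_toLp (Fin 2)).trans
      (volume_preserving_finTwoArrow ℝ)
  have hpre : square =
      ((MeasurableEquiv.toLp 2 (Fin 2 → ℝ)).symm.trans MeasurableEquiv.finTwoArrow) ⁻¹'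
        (Set.Icc (0 : ℝ) (1 / 2) ×ˢ Set.Icc (0 : ℝ) (1 / 2)) := by
    ext x
    exact Fin.forall_fin_two
  rw [← setIntegral_prod_mul, hpre, ← Measure.volume_eq_prod]
  exact hmp.setIntegral_preimage_emb (MeasurableEquiv.measurableEmbedding _)
    (fun z : ℝ × ℝ => p z.1 * q z.2) _

/-- For `k ≠ 0` the antiderivative is a multiple of `sin 2πkt`, which vanishes at both `0` and
`1/2`. -/
theorem integral_cosMode (k : ℤ) :
    ∫ t in Set.Icc (0 : ℝ) (1 / 2), cosMode k t = if k = 0 then 1 / 2 else 0 := by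
  rw [integral_Icc_eq_integral_Ioc, ← intervalIntegral.integral_of_le (by norm_num)]
  split_ifs with hk
  · subst hk
    simp [cosMode_zero]
  · have hk' : (2 * Real.pi * k : ℝ) ≠ 0 := by
      have : (k : ℝ) ≠ 0 := by exact_mod_cast hk
      positivity
    have hderiv : ∀ t ∈ Set.uIcc (0 : ℝ) (1 / 2),
        HasDerivAt (fun t => (2 * Real.pi * k)⁻¹ * sinMode k t) (cosMode k t) t := by
      intro t _
      refine ((hasDerivAt_sinMode k t).const_mul _).congr_deriv ?_
      rw [← mul_assoc, inv_mul_cancel₀ hk', one_mul]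
    rw [intervalIntegral.integral_eq_sub_of_hasDerivAt hderiv
      ((contDiff_cosMode k (n := 0)).continuous.intervalIntegrable _ _)]
    have h1 : sinMode k (1 / 2) = 0 := by
      rw [sinMode, show 2 * Real.pi * k * (1 / 2) = k * Real.pi by ring]
      exact Real.sin_int_mul_pi k
    have h0 : sinMode k 0 = 0 := by simp [sinMode]
    rw [h0, h1]
    simp

theorem continuous_cosMode (k : ℤ) : Continuous (cosMode k) :=
  (contDiff_cosMode k (n := 0)).continuous

theorem sinMode_mul_sinMode (m n : ℤ) (t : ℝ) :
    sinMode m t * sinMode n t = (cosMode (m - n) t - cosMode (m + n) t) / 2 := by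
  simp only [sinMode, cosMode]
  push_cast
  rw [mul_sub, mul_add, sub_mul, add_mul, Real.cos_sub, Real.cos_add]
  ring

theorem cosMode_mul_cosMode (m n : ℤ) (t : ℝ) :
    cosMode m t * cosMode n t = (cosMode (m - n) t + cosMode (m + n) t) / 2 := by
  simp only [cosMode]
  push_cast
  rw [mul_sub, mul_add, sub_mul, add_mul, Real.cos_sub, Real.cos_add]
  ring

theorem sinMode_mul_cosMode (m n : ℤ) (t : ℝ) :
    sinMode m t * cosMode n t = (sinMode (m + n) t + sinMode (m - n) t) / 2 := by
  simp only [sinMode, cosMode]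
  push_cast
  rw [mul_sub, mul_add, sub_mul, add_mul, Real.sin_sub, Real.sin_add]
  ring

theorem integrableOn_cosMode (k : ℤ) : IntegrableOn (cosMode k) (Set.Icc (0 : ℝ) (1 / 2)) :=
  (continuous_cosMode k).continuousOn.integrableOn_compact isCompact_Icc

theorem integral_sinMode_mul_sinMode {m n : ℤ} (hm : 0 < m) (hn : 0 < n) :
    ∫ t in Set.Icc (0 : ℝ) (1 / 2), sinMode m t * sinMode n t = if m = n then 1 / 4 else 0 := by
  simp only [sinMode_mul_sinMode]
  rw [integral_div, integral_sub (integrableOn_cosMode _) (integrableOn_cosMode _),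
    integral_cosMode, integral_cosMode, if_neg (show m + n ≠ 0 by lia)]
  simp only [sub_eq_zero]
  split_ifs <;> norm_num

/-- The square of the norm of `cos (2 π n ·)` on `[0, 1/2]`. -/
def cosNormSq (n : ℤ) : ℝ := if n = 0 then 1 / 2 else 1 / 4

theorem cosNormSq_pos (n : ℤ) : 0 < cosNormSq n := by
  unfold cosNormSq
  split_ifs <;> norm_num

theorem integral_cosMode_mul_cosMode {m n : ℤ} (hm : 0 ≤ m) (hn : 0 ≤ n) :
    ∫ t in Set.Icc (0 : ℝ) (1 / 2), cosMode m t * cosMode n t =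
      if m = n then cosNormSq n else 0 := by
  simp only [cosMode_mul_cosMode]
  rw [integral_div, integral_add (integrableOn_cosMode _) (integrableOn_cosMode _),
    integral_cosMode, integral_cosMode]
  simp only [sub_eq_zero, cosNormSq]
  split_ifs <;> first | lia | norm_num

theorem tensor_mul_tensor (p q r s : ℝ → ℝ) (x : Plane) :
    tensor p q x * tensor r s x = tensor (fun t => p t * r t) (fun t => q t * s t) x := by
  simp only [tensor]
  ring

theorem setIntegral_sinCos_mul_sinCos {m n m' n' : ℤ} (hm : 0 < m) (hn : 0 ≤ n) (hm' : 0 < m')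
    (hn' : 0 ≤ n') :
    ∫ x in square, sinCos m n x * sinCos m' n' x =
      if m = m' ∧ n = n' then cosNormSq n' / 4 else 0 := by
  simp only [sinCos, tensor_mul_tensor]
  rw [setIntegral_square_tensor, integral_sinMode_mul_sinMode hm hm',
    integral_cosMode_mul_cosMode hn hn']
  by_cases h1 : m = m' <;> by_cases h2 : n = n' <;> simp [h1, h2]
  ring

theorem setIntegral_cosSin_mul_cosSin {m n m' n' : ℤ} (hm : 0 < m) (hn : 0 ≤ n) (hm' : 0 < m')
    (hn' : 0 ≤ n') :
    ∫ x in square, cosSin m n x * cosSin m' n' x =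
      if m = m' ∧ n = n' then cosNormSq n' / 4 else 0 := by
  simp only [cosSin, tensor_mul_tensor]
  rw [setIntegral_square_tensor, integral_sinMode_mul_sinMode hm hm',
    integral_cosMode_mul_cosMode hn hn']
  by_cases h1 : m = m' <;> by_cases h2 : n = n' <;> simp [h1, h2]
  ring

/-- Both sides are the same product of two one-dimensional integrals, in opposite order. These
sine-cosine integrals over a half period need not vanish, so the mixed terms must cancel each other.
-/
theorem setIntegral_sinCos_mul_cosSin (m n m' n' : ℤ) :
    ∫ x in square, sinCos m n x * cosSin m' n' x =
      ∫ x in square, cosSin m n x * sinCos m' n' x := by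
  simp only [sinCos, cosSin, tensor_mul_tensor]
  rw [setIntegral_square_tensor, setIntegral_square_tensor, mul_comm]

theorem continuous_sinCos (m n : ℤ) : Continuous (sinCos m n) :=
  (contDiff_sinCos m n (k := 0)).continuous

theorem continuous_cosSin (m n : ℤ) : Continuous (cosSin m n) :=
  (contDiff_cosSin m n (k := 0)).continuous

theorem memLp_square_of_continuous {E : Type*} [NormedAddCommGroup E] {f : Plane → E}
    (hf : Continuous f) : MemLp f 2 (volume.restrict square) := by
  obtain ⟨C, hC⟩ := isCompact_square.exists_bound_of_continuousOn hf.continuousOn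
  exact MemLp.of_bound hf.aestronglyMeasurable C
    ((ae_restrict_iff' measurableSet_square).2 (Eventually.of_forall hC))

theorem integrableOn_square_mul_continuous {h f : Plane → ℝ}
    (hh : IntegrableOn h square) (hf : Continuous f) :
    IntegrableOn (fun x => h x * f x) square := by
  obtain ⟨C, hC⟩ := isCompact_square.exists_bound_of_continuousOn hf.continuousOn
  exact hh.mul_bdd (c := C) hf.aestronglyMeasurable
    ((ae_restrict_iff' measurableSet_square).2 (Eventually.of_forall hC))

/-! ### Completeness of the scalar modes -/

/-- Integration against an integrable function is a continuous functional on continuous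
functions. -/
theorem exists_clm_integral_mul {X : Type*} [TopologicalSpace X] [CompactSpace X]
    [MeasurableSpace X] [OpensMeasurableSpace X] [SecondCountableTopology X] {ν : Measure X}
    {k : X → ℝ} (hk : Integrable k ν) :
    ∃ L : C(X, ℝ) →L[ℝ] ℝ, ∀ φ : C(X, ℝ), L φ = ∫ z, k z * φ z ∂ν := by
  have hint : ∀ φ : C(X, ℝ), Integrable (fun z => k z * φ z) ν := fun φ =>
    hk.mul_bdd (c := ‖φ‖) φ.continuous.aestronglyMeasurable
      (Eventually.of_forall fun z => φ.norm_coe_le_norm z)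
  let L : C(X, ℝ) →ₗ[ℝ] ℝ :=
    { toFun := fun φ => ∫ z, k z * φ z ∂ν
      map_add' := fun φ ψ => by
        rw [← integral_add (hint φ) (hint ψ)]
        simp only [ContinuousMap.add_apply, mul_add]
      map_smul' := fun c φ => by
        rw [RingHom.id_apply, smul_eq_mul, ← integral_const_mul]
        simp only [ContinuousMap.smul_apply, smul_eq_mul]
        congr 1
        funext z
        ring }
  refine ⟨L.mkContinuous (∫ z, ‖k z‖ ∂ν) fun φ => ?_, fun φ => rfl⟩
  change ‖∫ z, k z * φ z ∂ν‖ ≤ _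
  rw [← integral_mul_const]
  refine norm_integral_le_of_norm_le (hk.norm.mul_const _) (Eventually.of_forall fun z => ?_)
  rw [norm_mul]
  gcongr
  exact φ.norm_coe_le_norm z

/-- The restriction of a continuous function to the square. -/
def restrictSquare (f : Plane → ℝ) (hf : Continuous f) : C(square, ℝ) :=
  ⟨fun z => f z, hf.comp continuous_subtype_val⟩

theorem cosMode_one_injOn : Set.InjOn (cosMode 1) (Set.Icc 0 (1 / 2)) := by
  intro s hs t ht h
  have hpi := Real.pi_pos
  have h' := Real.injOn_cos (x₁ := 2 * Real.pi * s) (x₂ := 2 * Real.pi * t)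
    ⟨by have := hs.1; positivity, by nlinarith [hs.2]⟩
    ⟨by have := ht.1; positivity, by nlinarith [ht.2]⟩ (by simpa [cosMode] using h)
  exact mul_left_cancel₀ (by positivity) h'

theorem sinMode_one_pos {t : ℝ} (h0 : 0 < t) (h1 : t < 1 / 2) : 0 < sinMode 1 t := by
  have hpi := Real.pi_pos
  rw [sinMode]
  refine Real.sin_pos_of_pos_of_lt_pi ?_ ?_
  · push_cast
    positivity
  · push_cast
    nlinarith

theorem continuous_coord (i : Fin 2) : Continuous fun x : Plane => x i :=
  (coordCLM i).continuous

theorem sinCos_mul_cosMode_fst (m n : ℤ) (x : Plane) :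
    sinCos m n x * cosMode 1 (x 0) = (sinCos (m + 1) n x + sinCos (m - 1) n x) / 2 := by
  simp only [sinCos, tensor]
  linear_combination cosMode n (x 1) * sinMode_mul_cosMode m 1 (x 0)

theorem sinCos_mul_cosMode_snd (m n : ℤ) (x : Plane) :
    sinCos m n x * cosMode 1 (x 1) = (sinCos m (n + 1) x + sinCos m (n - 1) x) / 2 := by
  simp only [sinCos, tensor]
  linear_combination sinMode m (x 0) * cosMode_mul_cosMode n 1 (x 1)

/-- An integrable function orthogonal to all `sin (2πmx) cos (2πny)` is orthogonal to
`sin (2πx)` times any continuous function. -/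
theorem setIntegral_eq_zero_of_orthogonal {h : Plane → ℝ} (hh : IntegrableOn h square)
    (horth : ∀ m n : ℤ, ∫ x in square, h x * sinCos m n x = 0) {G : Plane → ℝ}
    (hG : Continuous G) : ∫ x in square, h x * sinCos 1 0 x * G x = 0 := by
  have hcs : CompactSpace square := isCompact_iff_compactSpace.1 isCompact_square
  let ν : Measure square := Measure.comap Subtype.val (volume : Measure Plane)
  have hk : ∀ m n : ℤ, Integrable (fun z : square => h z * sinCos m n z) ν := fun m n =>
    (integrableOn_iff_comap_subtypeVal measurableSet_square).1
      (integrableOn_square_mul_continuous hh (continuous_sinCos m n))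
  choose L hL using fun m n => exists_clm_integral_mul (hk m n)
  have hcont0 : Continuous fun x : Plane => cosMode 1 (x 0) :=
    (continuous_cosMode 1).comp (continuous_coord 0)
  have hcont1 : Continuous fun x : Plane => cosMode 1 (x 1) :=
    (continuous_cosMode 1).comp (continuous_coord 1)
  let u : C(square, ℝ) := restrictSquare _ hcont0
  let v : C(square, ℝ) := restrictSquare _ hcont1
  have hone : ∀ m n, L m n 1 = 0 := by
    intro m n
    rw [hL]
    simp only [ContinuousMap.one_apply, mul_one]
    rw [← horth m n]
    exact integral_subtype_comap measurableSet_square (fun x => h x * sinCos m n x)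
  have hint : ∀ m n, ∀ φ : C(square, ℝ),
      Integrable (fun z : square => h z * sinCos m n z * φ z) ν := fun m n φ =>
    (hk m n).mul_bdd (c := ‖φ‖) φ.continuous.aestronglyMeasurable
      (Eventually.of_forall fun z => φ.norm_coe_le_norm z)
  have hu : ∀ m n φ, L m n (u * φ) = (L (m + 1) n φ + L (m - 1) n φ) / 2 := by
    intro m n φ
    rw [hL, hL, hL, ← integral_add (hint _ _ _) (hint _ _ _), ← integral_div]
    congr 1
    funext z
    have := sinCos_mul_cosMode_fst m n z
    change h z * sinCos m n z * (cosMode 1 ((z : Plane) 0) * φ z) = _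
    linear_combination h z * φ z * this
  have hv : ∀ m n φ, L m n (v * φ) = (L m (n + 1) φ + L m (n - 1) φ) / 2 := by
    intro m n φ
    rw [hL, hL, hL, ← integral_add (hint _ _ _) (hint _ _ _), ← integral_div]
    congr 1
    funext z
    have := sinCos_mul_cosMode_snd m n z
    change h z * sinCos m n z * (cosMode 1 ((z : Plane) 1) * φ z) = _
    linear_combination h z * φ z * this
  let A : Subalgebra ℝ C(square, ℝ) := Algebra.adjoin ℝ {u, v}
  -- Multiplication by `u` or `v` shifts a frequency by `±1`, so it preserves the common kernel of
  -- all the functionals `L m n`, though not obviously each single kernel. Hence all integer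
  -- frequencies are treated at once.
  have hmul : ∀ φ ∈ A, ∀ ψ : C(square, ℝ), (∀ m n, L m n ψ = 0) → ∀ m n, L m n (φ * ψ) = 0 := by
    intro φ hφ
    refine Algebra.adjoin_induction (p := fun φ _ => ∀ ψ : C(square, ℝ),
      (∀ m n, L m n ψ = 0) → ∀ m n, L m n (φ * ψ) = 0) ?_ ?_ ?_ ?_ hφ
    · rintro φ (rfl | rfl) ψ hψ m n
      · rw [hu, hψ, hψ]
        norm_num
      · rw [hv, hψ, hψ]
        norm_num
    · intro r ψ hψ m n
      rw [← Algebra.smul_def, map_smul, hψ, smul_zero]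
    · intro φ₁ φ₂ _ _ h₁ h₂ ψ hψ m n
      rw [add_mul, map_add, h₁ ψ hψ, h₂ ψ hψ, add_zero]
    · intro φ₁ φ₂ _ _ h₁ h₂ ψ hψ m n
      rw [mul_assoc]
      exact h₁ _ (h₂ ψ hψ) m n
  have hsep : A.SeparatesPoints := by
    intro z w hzw
    have hne : cosMode 1 ((z : Plane) 0) ≠ cosMode 1 ((w : Plane) 0) ∨
        cosMode 1 ((z : Plane) 1) ≠ cosMode 1 ((w : Plane) 1) := by
      by_contra hcon
      rw [not_or, not_not, not_not] at hcon
      exact hzw (Subtype.ext (plane_ext (cosMode_one_injOn (z.2 0) (w.2 0) hcon.1)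
        (cosMode_one_injOn (z.2 1) (w.2 1) hcon.2)))
    rcases hne with hne | hne
    · exact ⟨u, ⟨u, Algebra.subset_adjoin (Or.inl rfl), rfl⟩, hne⟩
    · exact ⟨v, ⟨v, Algebra.subset_adjoin (Or.inr rfl), rfl⟩, hne⟩
  -- Stone–Weierstrass: the two cosines separate the points of the square, since `cos 2πt` is
  -- injective on `[0, 1/2]`.
  have hdense := ContinuousMap.subalgebra_topologicalClosure_eq_top_of_separatesPoints A hsep
  have hclosed : IsClosed {φ : C(square, ℝ) | L 1 0 φ = 0} :=
    isClosed_eq (L 1 0).continuous continuous_const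
  have hall : ∀ φ : C(square, ℝ), L 1 0 φ = 0 := by
    intro φ
    have hφ : φ ∈ A.topologicalClosure := by
      rw [hdense]
      trivial
    refine closure_minimal (t := {φ : C(square, ℝ) | L 1 0 φ = 0}) (fun ψ hψ => ?_) hclosed hφ
    have h1 := hmul ψ hψ 1 hone 1 0
    rwa [mul_one] at h1
  have hfin := hall (restrictSquare G hG)
  rw [hL] at hfin
  rw [← hfin]
  exact (integral_subtype_comap measurableSet_square (fun x => h x * sinCos 1 0 x * G x)).symm

theorem ae_notMem_edge : ∀ᵐ x ∂(volume.restrict square : Measure Plane), ∀ i, ¬ OnEdge i x := by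
  refine ae_restrict_of_ae (ae_all_iff.2 fun i => ?_)
  rw [ae_iff]
  simpa using volume_onEdge i

/-- The modes are odd in `m` and even in `n`, so orthogonality extends to all integer frequencies.
Then `h sin 2πx` integrates to zero against every continuous function and vanishes almost
everywhere; the sine is positive off the edges and can be divided out. -/
theorem ae_eq_zero_of_orthogonal_sinCos {h : Plane → ℝ} (hh : IntegrableOn h square)
    (horth : ∀ m n : ℕ, ∫ x in square, h x * sinCos (m + 1) n x = 0) :
    h =ᵐ[volume.restrict square] 0 := by
  have hpos : ∀ m n : ℕ, ∫ x in square, h x * sinCos m n x = 0 := by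
    intro m n
    rcases m with _ | m
    · simp [sinCos, tensor, sinMode_zero]
    · exact_mod_cast horth m n
  have hcos : ∀ (m : ℤ) (n : ℤ) (x : Plane), sinCos m (-n) x = sinCos m n x := fun m n x => by
    simp [sinCos, tensor, cosMode_neg]
  have hsin : ∀ (m : ℤ) (n : ℤ) (x : Plane), sinCos (-m) n x = -sinCos m n x := fun m n x => by
    simp [sinCos, tensor, sinMode_neg]
  have hall : ∀ m n : ℤ, ∫ x in square, h x * sinCos m n x = 0 := by
    intro m n
    obtain ⟨a, rfl | rfl⟩ := m.eq_nat_or_neg <;> obtain ⟨b, rfl | rfl⟩ := n.eq_nat_or_neg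
    · exact hpos a b
    · simpa only [hcos] using hpos a b
    · simp only [hsin, mul_neg, integral_neg, hpos a b, neg_zero]
    · simp only [hsin, hcos, mul_neg, integral_neg, hpos a b, neg_zero]
  have hk : IntegrableOn (fun x => h x * sinCos 1 0 x) square :=
    integrableOn_square_mul_continuous hh (continuous_sinCos 1 0)
  have hzero := ae_eq_zero_of_integral_contDiff_smul_eq_zero
    (Integrable.locallyIntegrable hk) fun G hG _ => by
      have h1 := setIntegral_eq_zero_of_orthogonal hh hall hG.continuous
      simpa only [smul_eq_mul, mul_comm] using h1
  filter_upwards [hzero, ae_notMem_edge, ae_restrict_mem measurableSet_square] with x hx he hsq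
  have hs : sinCos 1 0 x ≠ 0 := by
    rw [sinCos, tensor, cosMode_zero, mul_one]
    exact (sinMode_one_pos
      (lt_of_le_of_ne (hsq 0).1 fun h => he 0 ⟨hsq, Or.inl h.symm⟩)
      (lt_of_le_of_ne (hsq 0).2 fun h => he 0 ⟨hsq, Or.inr h⟩)).ne'
  exact (mul_eq_zero.1 hx).resolve_right hs

/-! ### Exchange of the coordinates -/

/-- The reflection of the plane across the diagonal. -/
def planeSwap : Orth := LinearIsometryEquiv.piLpCongrLeft 2 ℝ ℝ (Equiv.swap (0 : Fin 2) 1)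

theorem planeSwap_zero (x : Plane) : planeSwap x 0 = x 1 := by
  simp [planeSwap]

theorem planeSwap_one (x : Plane) : planeSwap x 1 = x 0 := by
  simp [planeSwap]

theorem planeSwap_planeSwap (x : Plane) : planeSwap (planeSwap x) = x :=
  plane_ext (by rw [planeSwap_zero, planeSwap_one]) (by rw [planeSwap_one, planeSwap_zero])

theorem preimage_planeSwap_square : planeSwap ⁻¹' square = square := by
  ext x
  simp only [square, Set.mem_preimage, Set.mem_ofPred_eq, Fin.forall_fin_two, planeSwap_zero,
    planeSwap_one]
  exact and_comm

theorem measurePreserving_planeSwap :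
    MeasurePreserving planeSwap (volume.restrict square) (volume.restrict square) := by
  have h := planeSwap.measurePreserving.restrict_preimage measurableSet_square
  rwa [preimage_planeSwap_square] at h

theorem measurableEmbedding_planeSwap : MeasurableEmbedding planeSwap :=
  planeSwap.toHomeomorph.measurableEmbedding

theorem setIntegral_comp_planeSwap (f : Plane → ℝ) :
    ∫ x in square, f (planeSwap x) = ∫ x in square, f x :=
  measurePreserving_planeSwap.integral_comp measurableEmbedding_planeSwap f

theorem cosSin_planeSwap (m n : ℤ) (x : Plane) : cosSin m n (planeSwap x) = sinCos m n x := by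
  rw [cosSin, tensor, planeSwap_zero, planeSwap_one, mul_comm]
  rfl

theorem integrableOn_comp_planeSwap {h : Plane → ℝ} (hh : IntegrableOn h square) :
    IntegrableOn (fun x => h (planeSwap x)) square :=
  measurePreserving_planeSwap.integrable_comp_of_integrable hh

theorem ae_eq_zero_of_comp_planeSwap {h : Plane → ℝ}
    (hh : (fun x => h (planeSwap x)) =ᵐ[volume.restrict square] 0) :
    h =ᵐ[volume.restrict square] 0 := by
  have h1 := measurePreserving_planeSwap.quasiMeasurePreserving.ae_eq_comp hh
  filter_upwards [h1] with x hx
  simpa [planeSwap_planeSwap] using hx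

theorem setIntegral_mul_cosSin (h : Plane → ℝ) (m n : ℤ) :
    ∫ x in square, h x * cosSin m n x = ∫ x in square, h (planeSwap x) * sinCos m n x := by
  rw [← setIntegral_comp_planeSwap]
  simp only [cosSin_planeSwap]

theorem setIntegral_mul_sinCos_planeSwap (h : Plane → ℝ) (m n : ℤ) :
    ∫ x in square, h x * sinCos m n x = ∫ x in square, h (planeSwap x) * cosSin m n x := by
  rw [setIntegral_mul_cosSin]
  simp only [planeSwap_planeSwap]

theorem ae_eq_zero_of_orthogonal_cosSin {h : Plane → ℝ} (hh : IntegrableOn h square)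
    (horth : ∀ m n : ℕ, ∫ x in square, h x * cosSin (m + 1) n x = 0) :
    h =ᵐ[volume.restrict square] 0 := by
  refine ae_eq_zero_of_comp_planeSwap
    (ae_eq_zero_of_orthogonal_sinCos (integrableOn_comp_planeSwap hh) fun m n => ?_)
  rw [← setIntegral_mul_cosSin]
  exact horth m n

/-! ### Orthonormal families of eigenforms -/

theorem integrableOn_const_mul_mul {f g : Plane → ℝ} (hf : Continuous f) (hg : Continuous g)
    (c : ℝ) : IntegrableOn (fun x => c * (f x * g x)) square :=
  (continuous_const.mul (hf.mul hg)).continuousOn.integrableOn_compact isCompact_square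

theorem setIntegral_formInner_evenModeForm {m n m' n' : ℤ} (hm : 0 < m) (hn : 0 ≤ n) (hm' : 0 < m')
    (hn' : 0 ≤ n') (a b a' b' : ℝ) :
    ∫ x in square, formInner (evenModeForm a b m n x) (evenModeForm a' b' m' n' x) =
      if m = m' ∧ n = n' then (a * a' + b * b') * (cosNormSq n' / 4) else 0 := by
  have h : ∀ x, formInner (evenModeForm a b m n x) (evenModeForm a' b' m' n' x) =
      (a * a') * (sinCos m n x * sinCos m' n' x) +
        (b * b') * (cosSin m n x * cosSin m' n' x) := by
    intro x
    rw [evenModeForm, evenModeForm, formInner_oneForm_oneForm]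
    ring
  simp only [h]
  rw [integral_add
    (integrableOn_const_mul_mul (continuous_sinCos m n) (continuous_sinCos m' n') _)
    (integrableOn_const_mul_mul (continuous_cosSin m n) (continuous_cosSin m' n') _),
    integral_const_mul, integral_const_mul, setIntegral_sinCos_mul_sinCos hm hn hm' hn',
    setIntegral_cosSin_mul_cosSin hm hn hm' hn']
  split_ifs <;> ring

theorem setIntegral_formInner_oddModeForm {m n m' n' : ℤ} (hm : 0 < m) (hn : 0 ≤ n) (hm' : 0 < m')
    (hn' : 0 ≤ n') (a a' : ℝ) :
    ∫ x in square, formInner (oddModeForm a m n x) (oddModeForm a' m' n' x) =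
      if m = m' ∧ n = n' then (a * a' + a * a') * (cosNormSq n' / 4) else 0 := by
  rw [← setIntegral_formInner_evenModeForm hm hn hm' hn']
  congr 1
  funext x
  simp only [oddModeForm, evenModeForm, formInner_oneForm_oneForm]
  ring

/-- The contributions of the two components are equal and enter with opposite signs. -/
theorem setIntegral_formInner_evenModeForm_oddModeForm (m n m' n' : ℤ) (a a' : ℝ) :
    ∫ x in square, formInner (evenModeForm a a m n x) (oddModeForm a' m' n' x) = 0 := by
  have h : ∀ x, formInner (evenModeForm a a m n x) (oddModeForm a' m' n' x) =
      (a * a') * (sinCos m n x * cosSin m' n' x) -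
        (a * a') * (cosSin m n x * sinCos m' n' x) := by
    intro x
    rw [evenModeForm, oddModeForm, formInner_oneForm_oneForm]
    ring
  simp only [h]
  rw [integral_sub
    (integrableOn_const_mul_mul (continuous_sinCos m n) (continuous_cosSin m' n') _)
    (integrableOn_const_mul_mul (continuous_cosSin m n) (continuous_sinCos m' n') _),
    integral_const_mul, integral_const_mul, setIntegral_sinCos_mul_cosSin, sub_self]

theorem formInner_comm {p : ℕ} (a b : Plane [⋀^Fin p]→L[ℝ] ℝ) : formInner a b = formInner b a := by
  simp only [formInner, mul_comm]

/-! ### Normalized modes -/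

/-- The index set of the eigenforms. -/
abbrev ModeIndex : Type := ℕ × ℕ × Bool

/-- The eigenvalue of the eigenform with the given index. -/
def indexEigenvalue (i : ModeIndex) : ℝ := modeEigenvalue (i.1 + 1) i.2.1

/-- The factor that normalizes the forms on the square. -/
def squareFactor (n : ℤ) : ℝ := (√(cosNormSq n / 4))⁻¹

/-- The factor that normalizes the forms on the pillow. -/
def pillowFactor (n : ℤ) : ℝ := (√(cosNormSq n / 2))⁻¹

theorem squareFactor_mul_self (n : ℤ) : squareFactor n * squareFactor n * (cosNormSq n / 4) = 1 := by
  have h : 0 < cosNormSq n / 4 := by linarith [cosNormSq_pos n]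
  rw [squareFactor, ← mul_inv, Real.mul_self_sqrt h.le, inv_mul_cancel₀ h.ne']

theorem pillowFactor_mul_self (n : ℤ) : pillowFactor n * pillowFactor n * (cosNormSq n / 2) = 1 := by
  have h : 0 < cosNormSq n / 2 := by linarith [cosNormSq_pos n]
  rw [pillowFactor, ← mul_inv, Real.mul_self_sqrt h.le, inv_mul_cancel₀ h.ne']

theorem squareFactor_ne_zero (n : ℤ) : squareFactor n ≠ 0 := by
  intro h
  simpa [h] using squareFactor_mul_self n

theorem pillowFactor_ne_zero (n : ℤ) : pillowFactor n ≠ 0 := by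
  intro h
  simpa [h] using pillowFactor_mul_self n

/-- The orthonormal eigenforms of the square. -/
def squareMode : ModeIndex → Form 1
  | (m, n, false) => evenModeForm (squareFactor n) 0 (m + 1) n
  | (m, n, true) => evenModeForm 0 (squareFactor n) (m + 1) n

/-- The orthonormal eigenforms of the pillow. -/
def pillowMode : ModeIndex → Form 1
  | (m, n, false) => evenModeForm (pillowFactor n) (pillowFactor n) (m + 1) n
  | (m, n, true) => oddModeForm (pillowFactor n) (m + 1) n

theorem squareMode_mem_squareEigenforms (i : ModeIndex) :
    squareMode i ∈ squareEigenforms 1 (indexEigenvalue i) := by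
  obtain ⟨m, n, _ | _⟩ := i <;> exact evenModeForm_mem_squareEigenforms _ _ _ _

theorem squareMode_mem_orbifoldEigenforms (i : ModeIndex) :
    squareMode i ∈ orbifoldEigenforms 1 squareGroup (indexEigenvalue i) := by
  obtain ⟨m, n, _ | _⟩ := i <;> exact evenModeForm_mem_orbifoldEigenforms_squareGroup _ _ _ _

theorem pillowMode_mem_orbifoldEigenforms (i : ModeIndex) :
    pillowMode i ∈ orbifoldEigenforms 1 pillowGroup (indexEigenvalue i) := by
  obtain ⟨m, n, _ | _⟩ := i
  · exact evenModeForm_mem_orbifoldEigenforms_pillowGroup _ _ _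
  · exact oddModeForm_mem_orbifoldEigenforms_pillowGroup _ _ _

theorem squareMode_orthonormal (i j : ModeIndex) :
    ∫ x in square, formInner (squareMode i x) (squareMode j x) = if i = j then 1 else 0 := by
  obtain ⟨m, n, b⟩ := i
  obtain ⟨m', n', b'⟩ := j
  cases b <;> cases b' <;> simp only [squareMode]
  all_goals
    rw [setIntegral_formInner_evenModeForm (by lia) (by lia) (by lia) (by lia)]
    by_cases h : m = m' ∧ n = n'
    · obtain ⟨rfl, rfl⟩ := h
      simp [squareFactor_mul_self]
    · rw [if_neg (by lia), if_neg (by grind)]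

theorem pillowMode_orthonormal (i j : ModeIndex) :
    ∫ x in square, formInner (pillowMode i x) (pillowMode j x) = if i = j then 1 else 0 := by
  obtain ⟨m, n, b⟩ := i
  obtain ⟨m', n', b'⟩ := j
  cases b <;> cases b' <;> simp only [pillowMode]
  · rw [setIntegral_formInner_evenModeForm (by lia) (by lia) (by lia) (by lia)]
    by_cases h : m = m' ∧ n = n'
    · obtain ⟨rfl, rfl⟩ := h
      simp only [and_self, if_true]
      linear_combination pillowFactor_mul_self n
    · rw [if_neg (by lia), if_neg (by simpa using h)]
  · rw [setIntegral_formInner_evenModeForm_oddModeForm]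
    simp
  · simp only [formInner_comm (oddModeForm _ _ _ _)]
    rw [setIntegral_formInner_evenModeForm_oddModeForm]
    simp
  · rw [setIntegral_formInner_oddModeForm (by lia) (by lia) (by lia) (by lia)]
    by_cases h : m = m' ∧ n = n'
    · obtain ⟨rfl, rfl⟩ := h
      simp only [and_self, if_true]
      linear_combination pillowFactor_mul_self n
    · rw [if_neg (by lia), if_neg (by simpa using h)]

theorem memLp_squareMode (i : ModeIndex) : MemLp (squareMode i) 2 (volume.restrict square) :=
  memLp_square_of_continuous (squareMode_mem_squareEigenforms i).1.continuous

theorem memLp_pillowMode (i : ModeIndex) : MemLp (pillowMode i) 2 (volume.restrict square) :=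
  memLp_square_of_continuous (pillowMode_mem_orbifoldEigenforms i).1.continuous

theorem integrableOn_component {ω : Form 1} (hω : MemLp ω 2 (volume.restrict square)) (i : Fin 2) :
    IntegrableOn (fun x => ω x (fun _ => frame i)) square :=
  (ContinuousAlternatingMap.apply ℝ Plane ℝ (fun _ : Fin 1 => frame i)).integrable_comp
    (hω.integrable (by norm_num))

theorem ae_eq_zero_of_components {ω : Form 1}
    (h0 : (fun x => ω x (fun _ => frame 0)) =ᵐ[volume.restrict square] 0)
    (h1 : (fun x => ω x (fun _ => frame 1)) =ᵐ[volume.restrict square] 0) :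
    ω =ᵐ[volume.restrict square] 0 := by
  filter_upwards [h0, h1] with x hx0 hx1
  refine alternating_one_ext fun i => ?_
  fin_cases i
  exacts [hx0, hx1]

theorem squareMode_complete {ω : Form 1} (hω : MemLp ω 2 (volume.restrict square))
    (h : ∀ i, ∫ x in square, formInner (ω x) (squareMode i x) = 0) :
    ω =ᵐ[volume.restrict square] 0 := by
  refine ae_eq_zero_of_components
    (ae_eq_zero_of_orthogonal_sinCos (integrableOn_component hω 0) fun m n => ?_)
    (ae_eq_zero_of_orthogonal_cosSin (integrableOn_component hω 1) fun m n => ?_)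
  · have h1 := h (m, n, false)
    simp only [squareMode, evenModeForm, formInner_oneForm, zero_mul, mul_zero, add_zero,
      mul_left_comm _ (squareFactor n)] at h1
    rw [integral_const_mul] at h1
    exact (mul_eq_zero.1 h1).resolve_left (squareFactor_ne_zero n)
  · have h1 := h (m, n, true)
    simp only [squareMode, evenModeForm, formInner_oneForm, zero_mul, mul_zero, zero_add,
      mul_left_comm _ (squareFactor n)] at h1
    rw [integral_const_mul] at h1
    exact (mul_eq_zero.1 h1).resolve_left (squareFactor_ne_zero n)

/-- Let `s` be the exchange of coordinates. Since `s` interchanges the two kinds of scalar modes,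
orthogonality to the even forms says that `f + g ∘ s` is orthogonal to every `sinCos` mode, and
orthogonality to the odd forms that `f - g ∘ s` is orthogonal to every `cosSin` mode. Scalar
completeness kills both, hence `f` and `g ∘ s`. -/
theorem pillowMode_complete {ω : Form 1} (hω : MemLp ω 2 (volume.restrict square))
    (h : ∀ i, ∫ x in square, formInner (ω x) (pillowMode i x) = 0) :
    ω =ᵐ[volume.restrict square] 0 := by
  set f : Plane → ℝ := fun x => ω x (fun _ => frame 0) with hf
  set g : Plane → ℝ := fun x => ω x (fun _ => frame 1) with hg
  have fi : IntegrableOn f square := integrableOn_component hω 0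
  have gi : IntegrableOn g square := integrableOn_component hω 1
  have gi' := integrableOn_comp_planeSwap gi
  have hplus : (fun x => f x + g (planeSwap x)) =ᵐ[volume.restrict square] 0 := by
    refine ae_eq_zero_of_orthogonal_sinCos (fi.add gi') fun m n => ?_
    have h1 := h (m, n, false)
    have h2 : ∀ x, formInner (ω x) (pillowMode (m, n, false) x) =
        pillowFactor n * (f x * sinCos (m + 1) n x + g x * cosSin (m + 1) n x) := by
      intro x
      rw [pillowMode, evenModeForm, formInner_oneForm]
      ring
    simp only [h2] at h1
    rw [integral_const_mul, integral_add (integrableOn_square_mul_continuous fi (continuous_sinCos _ _))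
      (integrableOn_square_mul_continuous gi (continuous_cosSin _ _)), setIntegral_mul_cosSin] at h1
    simp only [add_mul]
    rw [integral_add (integrableOn_square_mul_continuous fi (continuous_sinCos _ _))
      (integrableOn_square_mul_continuous gi' (continuous_sinCos _ _))]
    exact (mul_eq_zero.1 h1).resolve_left (pillowFactor_ne_zero n)
  have hminus : (fun x => f x - g (planeSwap x)) =ᵐ[volume.restrict square] 0 := by
    refine ae_eq_zero_of_orthogonal_cosSin (fi.sub gi') fun m n => ?_
    have h1 := h (m, n, true)
    have h2 : ∀ x, formInner (ω x) (pillowMode (m, n, true) x) =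
        pillowFactor n * (f x * cosSin (m + 1) n x - g x * sinCos (m + 1) n x) := by
      intro x
      rw [pillowMode, oddModeForm, formInner_oneForm]
      ring
    simp only [h2] at h1
    rw [integral_const_mul, integral_sub (integrableOn_square_mul_continuous fi (continuous_cosSin _ _))
      (integrableOn_square_mul_continuous gi (continuous_sinCos _ _)), setIntegral_mul_sinCos_planeSwap g] at h1
    simp only [sub_mul]
    rw [integral_sub (integrableOn_square_mul_continuous fi (continuous_cosSin _ _))
      (integrableOn_square_mul_continuous gi' (continuous_cosSin _ _))]
    exact (mul_eq_zero.1 h1).resolve_left (pillowFactor_ne_zero n)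
  refine ae_eq_zero_of_components ?_ (ae_eq_zero_of_comp_planeSwap ?_)
  · filter_upwards [hplus, hminus] with x h1 h2
    have h1 : f x + g (planeSwap x) = 0 := h1
    have h2 : f x - g (planeSwap x) = 0 := h2
    change f x = 0
    linarith
  · filter_upwards [hplus, hminus] with x h1 h2
    have h1 : f x + g (planeSwap x) = 0 := h1
    have h2 : f x - g (planeSwap x) = 0 := h2
    change g (planeSwap x) = 0
    linarith

/-! ### Enumeration of the eigenvalues -/

/-- The eigenvalue in units of `4 π²`. -/
def indexNorm (i : ModeIndex) : ℕ := (i.1 + 1) ^ 2 + i.2.1 ^ 2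

theorem indexEigenvalue_eq (i : ModeIndex) :
    indexEigenvalue i = 4 * Real.pi ^ 2 * indexNorm i := by
  simp only [indexEigenvalue, modeEigenvalue, indexNorm]
  push_cast
  ring

/-- The position of a mode among the modes with the same eigenvalue. -/
def indexOffset (i : ModeIndex) : ℕ :=
  2 * (i.1 * (indexNorm i + 1) + i.2.1) + if i.2.2 then 1 else 0

/-- An injective numbering of the modes by which the eigenvalue increases. -/
def indexCode (i : ModeIndex) : ℕ := (indexNorm i + 1) ^ 3 + indexOffset i

theorem fst_lt_indexNorm (i : ModeIndex) : i.1 < indexNorm i + 1 := by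
  unfold indexNorm
  nlinarith

theorem snd_lt_indexNorm (i : ModeIndex) : i.2.1 < indexNorm i + 1 := by
  unfold indexNorm
  nlinarith

theorem indexOffset_lt (i : ModeIndex) : indexOffset i < 2 * (indexNorm i + 1) ^ 2 := by
  have h1 := fst_lt_indexNorm i
  have h2 := snd_lt_indexNorm i
  have h3 : i.1 * (indexNorm i + 1) + i.2.1 + 1 ≤ (indexNorm i + 1) ^ 2 := by nlinarith
  unfold indexOffset
  split_ifs <;> lia

/-- With `K = indexNorm i + 1`, the offset is below `2K²`, less than the gap `3K² + 3K + 1` between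
consecutive cubes. The cubes thus separate the eigenvalues. -/
theorem indexCode_lt {i j : ModeIndex} (h : indexNorm i < indexNorm j) :
    indexCode i < indexCode j := by
  have h1 := indexOffset_lt i
  have h2 : (indexNorm i + 1 + 1) ^ 3 ≤ (indexNorm j + 1) ^ 3 := Nat.pow_le_pow_left (by lia) 3
  unfold indexCode
  nlinarith

/-- The code determines the norm. Given the norm, parity of the offset recovers the Boolean, and
half the offset is a number in base `K` with last digit `n` and leading part `m`. -/
theorem indexCode_injective : Function.Injective indexCode := by
  intro i j h
  have hN : indexNorm i = indexNorm j := by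
    rcases lt_trichotomy (indexNorm i) (indexNorm j) with hlt | heq | hgt
    · exact absurd h (indexCode_lt hlt).ne
    · exact heq
    · exact absurd h (indexCode_lt hgt).ne'
  have ho : indexOffset i = indexOffset j := by
    unfold indexCode at h
    rw [hN] at h
    lia
  have h1 := snd_lt_indexNorm i
  have h2 := snd_lt_indexNorm j
  unfold indexOffset at ho
  rw [hN] at ho h1
  generalize indexNorm j + 1 = K at *
  obtain ⟨m, n, b⟩ := i
  obtain ⟨m', n', b'⟩ := j
  have hb : b = b' := by
    cases b <;> cases b' <;> first | rfl | (simp at ho; lia)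
  subst hb
  have hmn : m * K + n = m' * K + n' := by
    simp only at ho
    lia
  have hn : n = n' := by
    have := congrArg (· % K) hmn
    simpa [Nat.mod_eq_of_lt h1, Nat.mod_eq_of_lt h2] using this
  subst hn
  have hm : m = m' := Nat.eq_of_mul_eq_mul_right (by lia : 0 < K) (by lia)
  rw [hm]

/-- The codes form an infinite set of natural numbers, and its increasing enumeration lists every
mode once with the eigenvalues in order. -/
theorem exists_equiv_monotone_indexEigenvalue :
    ∃ e : ℕ ≃ ModeIndex, Monotone fun k => indexEigenvalue (e k) := by
  have hinf : Infinite (Set.range indexCode) :=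
    (Set.infinite_range_of_injective indexCode_injective).to_subtype
  let o : ℕ ≃o Set.range indexCode := Nat.Subtype.orderIsoOfNat _
  let c : ModeIndex ≃ Set.range indexCode := Equiv.ofInjective indexCode indexCode_injective
  refine ⟨o.toEquiv.trans c.symm, fun k l hkl => ?_⟩
  have hc : ∀ k, indexCode (c.symm (o k)) = o k := fun k =>
    congrArg Subtype.val (c.apply_symm_apply (o k))
  have hle : indexCode (c.symm (o k)) ≤ indexCode (c.symm (o l)) := by
    rw [hc, hc]
    exact o.monotone hkl
  have hN : indexNorm (c.symm (o k)) ≤ indexNorm (c.symm (o l)) :=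
    not_lt.1 fun hlt => absurd (indexCode_lt hlt) (not_lt.2 hle)
  change indexEigenvalue (c.symm (o k)) ≤ indexEigenvalue (c.symm (o l))
  rw [indexEigenvalue_eq, indexEigenvalue_eq]
  gcongr

theorem tendsto_indexEigenvalue {e : ℕ ≃ ModeIndex}
    (he : Monotone fun k => indexEigenvalue (e k)) :
    Tendsto (fun k => indexEigenvalue (e k)) atTop atTop := by
  refine tendsto_atTop_atTop_of_monotone he fun b => ?_
  obtain ⟨m, hm⟩ := exists_nat_ge b
  -- For a monotone sequence it suffices to exceed each bound once; the mode with `n = 0` has norm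
  -- `(m + 1)² ≥ m`, and `4π² ≥ 1`.
  refine ⟨e.symm (m, 0, false), hm.trans ?_⟩
  have hN : m ≤ indexNorm (m, 0, false) := (Nat.lt_succ_iff.1 (fst_lt_indexNorm (m, 0, false)))
  have hN' : (m : ℝ) ≤ indexNorm (m, 0, false) := by exact_mod_cast hN
  have hpi : (1 : ℝ) ≤ 4 * Real.pi ^ 2 := by nlinarith [Real.pi_gt_three]
  rw [Equiv.apply_symm_apply, indexEigenvalue_eq]
  nlinarith

theorem isEigenvalueList_of_family {φ : ModeIndex → Form 1} {Eig : ℝ → Set (Form 1)}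
    (e : ℕ ≃ ModeIndex) (he : Monotone fun k => indexEigenvalue (e k))
    (heig : ∀ i, φ i ∈ Eig (indexEigenvalue i)) (hLp : ∀ i, MemLp (φ i) 2 (volume.restrict square))
    (horth : ∀ i j, ∫ x in square, formInner (φ i x) (φ j x) = if i = j then 1 else 0)
    (hcomplete : ∀ ω : Form 1, MemLp ω 2 (volume.restrict square) →
      (∀ i, ∫ x in square, formInner (ω x) (φ i x) = 0) → ω =ᵐ[volume.restrict square] 0) :
    IsEigenvalueList square Eig fun k => indexEigenvalue (e k) := by
  refine ⟨fun k => ?_, he, tendsto_indexEigenvalue he, fun k => φ (e k), fun k => heig _,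
    fun k => hLp _, fun k l => ?_, fun ω hω h => hcomplete ω hω fun i => ?_⟩
  · beta_reduce
    rw [indexEigenvalue_eq]
    positivity
  · rw [horth]
    simp only [e.injective.eq_iff]
  · simpa using h (e.symm i)

/-- One numbering of the modes serves all three problems, so the eigenvalue lists coincide term by
term. -/
theorem exists_common_spectrum :
    ∃ lam : ℕ → ℝ, IsOrbifoldSpectrum 1 pillowGroup lam ∧ IsOrbifoldSpectrum 1 squareGroup lam ∧
      IsSquareAbsoluteSpectrum 1 lam := by
  obtain ⟨e, he⟩ := exists_equiv_monotone_indexEigenvalue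
  refine ⟨fun k => indexEigenvalue (e k),
    ⟨square, isFundamentalDomain_square_pillowGroup, ?_⟩,
    ⟨square, isFundamentalDomain_square_squareGroup, ?_⟩, ?_⟩
  · exact isEigenvalueList_of_family e he pillowMode_mem_orbifoldEigenforms memLp_pillowMode
      pillowMode_orthonormal fun ω => pillowMode_complete
  · exact isEigenvalueList_of_family e he squareMode_mem_orbifoldEigenforms memLp_squareMode
      squareMode_orthonormal fun ω => squareMode_complete
  · exact isEigenvalueList_of_family e he squareMode_mem_squareEigenforms memLp_squareMode
      squareMode_orthonormal fun ω => squareMode_complete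

end FlatOrbifold

end

open FlatOrbifold in
theorem mainTheorem8 :
    -- the holonomy groups
    (IsCyclic rotGroup ∧ Nat.card rotGroup = 4 ∧ IsKleinFour kleinGroup) ∧
    -- both groups act properly discontinuously
    (ProperlyDiscontinuousSMul pillowGroup Plane ∧
      ProperlyDiscontinuousSMul squareGroup Plane) ∧
    -- the first quotient is a sphere whose singular points are three cone points of orders 4, 4, 2
    (Nonempty (Underlying pillowGroup ≃ₜ Metric.sphere (0 : EuclideanSpace ℝ (Fin 3)) 1) ∧
      (∀ x : Plane, IsSingular pillowGroup x ↔
        proj pillowGroup x = proj pillowGroup !₂[0, 0] ∨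
        proj pillowGroup x = proj pillowGroup !₂[1 / 2, 1 / 2] ∨
        proj pillowGroup x = proj pillowGroup !₂[1 / 2, 0]) ∧
      proj pillowGroup !₂[0, 0] ≠ proj pillowGroup !₂[1 / 2, 1 / 2] ∧
      proj pillowGroup !₂[0, 0] ≠ proj pillowGroup !₂[1 / 2, 0] ∧
      proj pillowGroup !₂[1 / 2, 1 / 2] ≠ proj pillowGroup !₂[1 / 2, 0] ∧
      proj pillowGroup !₂[1 / 2, 0] = proj pillowGroup !₂[0, 1 / 2] ∧
      IsConePoint pillowGroup 4 !₂[0, 0] ∧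
      IsConePoint pillowGroup 4 !₂[1 / 2, 1 / 2] ∧
      IsConePoint pillowGroup 2 !₂[1 / 2, 0]) ∧
    -- the second quotient is the square (isometrically), with edges reflectors and corners dihedral
    (IsHomeomorph (fun x : square => proj squareGroup x) ∧
      (∀ x ∈ square, ∀ y ∈ square, ∀ g ∈ squareGroup, dist x y ≤ dist x (g y)) ∧
      (∀ x ∈ square, (∀ i, ¬ OnEdge i x) → ¬ IsSingular squareGroup x) ∧
      (∀ x ∈ square, (∃! i, OnEdge i x) → IsReflectorPoint squareGroup x) ∧
      (∀ x ∈ square, (∀ i, OnEdge i x) → IsDihedralPoint squareGroup 2 x)) ∧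
    -- the 1-spectra of both orbifolds and of the square with absolute boundary conditions coincide
    (∃ lam : ℕ → ℝ, IsOrbifoldSpectrum 1 pillowGroup lam ∧ IsOrbifoldSpectrum 1 squareGroup lam ∧
      IsSquareAbsoluteSpectrum 1 lam) := by
  refine ⟨⟨?_, card_rotGroup, isKleinFour_kleinGroup⟩,
    ⟨properlyDiscontinuousSMul_latticeSemidirect finite_rotGroup,
      properlyDiscontinuousSMul_latticeSemidirect finite_kleinGroup⟩,
    ⟨nonempty_homeomorph_sphere, fun _ => isSingular_pillowGroup_iff_proj, proj_origin_ne_center,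
      proj_origin_ne_edge, proj_center_ne_edge, proj_edge_eq, isConePoint_origin,
      isConePoint_center, isConePoint_edge⟩,
    ⟨isHomeomorph_square_proj, fun _ hx _ hy _ hg => dist_le_dist_squareGroup hx hy hg,
      fun _ => not_isSingular_squareGroup, fun _ => isReflectorPoint_squareGroup,
      fun _ => isDihedralPoint_squareGroup⟩,
    exists_common_spectrum⟩
  unfold rotGroup
  infer_instance
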